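/- **Proposition 3.8.** Let $G$ and $H$ be locally compact second countable (Hausdorff) groups and let $\Gamma < G\times H$ be a uniform lattice (a discrete cocompact subgroup) whose projection to $G$ is injective and whose projection $\Gamma_H$ to $H$ is dense. Let $Y=(G\times H)/\Gamma$ and fix a compact set $\mathcal F\subset G\times H$ with dense interior such that $\mathcal F\,\Gamma=G\times H$ and such that the interior of $\mathcal F$ is mapped homeomorphically onto a dense open subset of $Y$. Let $W\subset H$ be a compact set with non-empty interior which is $\Gamma$-regular, i.e. $W$ has dense interior, $\partial W$ is a Haar null set, $hW=W$ only for $h=e$, and $\partial W\cap\Gamma_H=\emptyset$. Let $\Lambda=\pi_G(\Gamma\cap(G\times W))\subset G$ be the associated regular uniform model set, and assume that $\Lambda=\Lambda^{-1}$ and that the window is large, i.e. $\pi_H(\mathcal F)\subset W$. Let $\Lambda^\infty$ be the subgroup of $G$ generated by $\Lambda$, and assume that $\Lambda^\infty=\pi_G(\Gamma)$, so that $\pi_G$ restricts to an isomorphism $\Gamma\to\Lambda^\infty$. Let $X_\Lambda$ be the hull of $\Lambda$, i.e. the closure of the orbit $\{g\Lambda : g\in G\}$ in the space of closed subsets of $G$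 with the Chabauty–Fell topology. Let $1<p<\infty$ and let $E$ be a (real) $L^p$-space, i.e. a Banach space isometrically isomorphic to $L^p(\Omega,\mu)$ for a $\sigma$-finite measure $\mu$ on a standard Borel space $\Omega$. Let $\rho_0=(\pi_0,b_0)$ be an affine isometric action of the (discrete) group $\Lambda^\infty$ on $E$, and let $\rho=\rho_0\circ\pi_G|_\Gamma=(\pi,b)$ be the corresponding action of $\Gamma$. An *affine $L^p$-action* of a topological group is a continuous affine isometric action on an $L^p$-space. Induction is defined as follows. Let $L$ be a group acting on a probability space $(X,\nu)$ by measure-preserving transformations, let $s:X\to L$ be a map, and put $\beta_s(g,x)=s(gx)^{-1}g\,s(x)$. If $\beta_s(g^{-1},x)^{-1}=s(x)^{-1}g\,s(g^{-1}x)$ lies in a subgroup $\Delta<L$ for every $g$ and almost every $x$, then the $(\nu,s)$-induced action of an affine isometric action $\rho$ of $\Delta$ on $E$ is the action $\widehat\rho$ of $L$ on $L^p(X,\nu;E)$ given by $$(\widehat\rho(g)f)(x)=\rho\big(\beta_s(g^{-1},x)^{-1}\big)\big(f(g^{-1}x)\big).$$ Then $X_\Lambda$ carries a unique $G$-invariant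 Borel probability measure $\nu$, $Y$ carries a unique $G\times H$-invariant Borel probability measure $m_Y$, and there exist Borel maps $\sigma:X_\Lambda\to G$ and $s:Y\to G\times H$ with relatively compact images such that $\sigma(P)\in P$ for all $P\in X_\Lambda$ and $s(y)\Gamma=y$ for all $y\in Y$. For all such $\sigma$ and $s$, the $(\nu,\sigma)$-induced action $\nu\text{-}\mathrm{Ind}_{(\Lambda,\Lambda^\infty)}^G(\pi_0,b_0)$ of $G$ on $L^p(X_\Lambda,\nu;E)$ and the $(m_Y,s)$-induced action $\mathrm{Ind}_\Gamma^{G\times H}(\pi,b)$ of $G\times H$ on $L^p(Y,m_Y;E)$ are well-defined affine $L^p$-actions, and $$\nu\text{-}\mathrm{Ind}_{(\Lambda,\Lambda^\infty)}^G(\pi_0,b_0)\;\cong\;\Big(\mathrm{Ind}_\Gamma^{G\times H}(\pi,b)\Big)\Big|_{G},$$ i.e. the two actions of $G\cong G\times\{e\}$ are intertwined by a bijective affine isometry between the two spaces. In particular, the action $\nu\text{-}\mathrm{Ind}_{(\Lambda,\Lambda^\infty)}^G(\pi_0,b_0)$ of $G$ extends to an affine $L^p$-action of $G\times H$ on $L^p(X_\Lambda,\nu;E)$.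 -/

import Mathlib

open MeasureTheory
open scoped ENNReal Pointwise

namespace ModelSets

/-! ### The Chabauty-Fell space and the hull -/

/-- The collection of closed subsets of a topological space `G`. (A separate structure, so that
it carries the Chabauty-Fell topology and no other one.) -/
@[ext]
structure ClosedSubset (G : Type*) [TopologicalSpace G] where
  carrier : Set G
  isClosed' : IsClosed carrier

section Chabauty

variable {G : Type*} [TopologicalSpace G]

/-- The Chabauty-Fell topology: it is generated by the sets of all closed `P` that miss a given
compact set, and of all closed `P` that meet a given open set. -/
instance : TopologicalSpace (ClosedSubset G) :=
  TopologicalSpace.generateFrom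
    ({U | ∃ K : Set G, IsCompact K ∧ U = {P | P.carrier ∩ K = ∅}} ∪
      {U | ∃ V : Set G, IsOpen V ∧ U = {P | (P.carrier ∩ V).Nonempty}})

/-- The Borel sigma-algebra of the Chabauty-Fell topology. -/
instance : MeasurableSpace (ClosedSubset G) := borel _

instance : BorelSpace (ClosedSubset G) := ⟨rfl⟩

variable [Group G] [IsTopologicalGroup G]

/-- `G` acts on its closed subsets by left translation. -/
instance : MulAction G (ClosedSubset G) where
  smul g P := ⟨g • P.carrier, P.isClosed'.smul g⟩
  one_smul P := ClosedSubset.ext (one_smul G P.carrier)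
  mul_smul g h P := ClosedSubset.ext (mul_smul g h P.carrier)

theorem carrier_smul (g : G) (P : ClosedSubset G) : (g • P).carrier = g • P.carrier := rfl

instance : ContinuousConstSMul G (ClosedSubset G) where
  continuous_const_smul g := by
    refine continuous_generateFrom_iff.2 ?_
    rintro U (⟨K, hK, rfl⟩ | ⟨V, hV, rfl⟩)
    · refine TopologicalSpace.isOpen_generateFrom_of_mem (Or.inl ⟨g⁻¹ • K, hK.smul g⁻¹, ?_⟩)
      ext P
      simp only [Set.mem_preimage, Set.mem_ofPred_eq, carrier_smul]
      rw [← Set.smul_set_eq_empty (a := g⁻¹), Set.smul_set_inter, inv_smul_smul]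
    · refine TopologicalSpace.isOpen_generateFrom_of_mem (Or.inr ⟨g⁻¹ • V, hV.smul g⁻¹, ?_⟩)
      ext P
      simp only [Set.mem_preimage, Set.mem_ofPred_eq, carrier_smul]
      rw [← Set.smul_set_nonempty (a := g⁻¹), Set.smul_set_inter, inv_smul_smul]

/-- The hull of a (closed) subset `Λ` of `G`: the closure of the orbit of `Λ` under left
translations in the Chabauty-Fell topology. -/
def hull (Λ : Set G) : Set (ClosedSubset G) :=
  closure {P | ∃ g : G, P.carrier = g • Λ}

theorem smul_mem_hull {Λ : Set G} (g : G) {P : ClosedSubset G} (hP : P ∈ hull Λ) :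
    g • P ∈ hull Λ := by
  refine map_mem_closure (continuous_const_smul g) hP ?_
  rintro Q ⟨h, hQ⟩
  exact ⟨g * h, by rw [carrier_smul, hQ, mul_smul]⟩

/-- The action of `G` on the hull by left translations. -/
instance (Λ : Set G) : MulAction G (hull Λ) where
  smul g P := ⟨g • P.1, smul_mem_hull g P.2⟩
  one_smul P := Subtype.ext (one_smul G P.1)
  mul_smul g h P := Subtype.ext (mul_smul g h P.1)

end Chabauty

/-! ### Uniform cut-and-project schemes and regular model sets -/

section CutAndProject

variable {G H : Type*} [Group G] [TopologicalSpace G] [Group H] [TopologicalSpace H]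

/-- `(G, H, Γ)` is a uniform cut-and-project scheme: `Γ` is a uniform lattice (discrete and
cocompact) in `G × H` which projects injectively to `G` and densely to `H`. -/
structure IsUniformCutAndProjectScheme (Γ : Subgroup (G × H)) : Prop where
  discrete : DiscreteTopology Γ
  cocompact : CompactSpace ((G × H) ⧸ Γ)
  injective_fst : Set.InjOn Prod.fst (Γ : Set (G × H))
  dense_snd : Dense (Prod.snd '' (Γ : Set (G × H)))

/-- The (weak) model set with window `W`: the projection to `G` of `Γ ∩ (G × W)`. -/
def modelSet (Γ : Subgroup (G × H)) (W : Set H) : Set G :=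
  Prod.fst '' ((Γ : Set (G × H)) ∩ {x | x.2 ∈ W})

/-- `W` is a `Γ`-regular window: it is compact with non-empty interior, the interior is dense in
`W`, `W` is Jordan measurable (the boundary is a Haar null set), `W` is aperiodic, and its
boundary contains no point of the projection of `Γ` to `H`. -/
structure IsRegularWindow [IsTopologicalGroup H] [LocallyCompactSpace H] [MeasurableSpace H]
    [BorelSpace H] (Γ : Subgroup (G × H)) (W : Set H) : Prop where
  compact : IsCompact W
  interior_nonempty : (interior W).Nonempty
  dense_interior : W ⊆ closure (interior W)
  jordan : (Measure.haar : Measure H) (frontier W) = 0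
  aperiodic : ∀ h : H, h • W = W → h = 1
  frontier_disjoint : Disjoint (frontier W) (Prod.snd '' (Γ : Set (G × H)))

/-- `F` is a compact subset of `G × H` with dense interior that meets every coset `xΓ` and whose
interior is mapped homeomorphically onto a dense open subset of `(G × H)/Γ`. -/
structure IsFundamentalSet (Γ : Subgroup (G × H)) (F : Set (G × H)) : Prop where
  compact : IsCompact F
  dense_interior : F ⊆ closure (interior F)
  covers : F * (Γ : Set (G × H)) = Set.univ
  interior_embedding : Topology.IsOpenEmbedding
    (fun x : interior F => (QuotientGroup.mk x.1 : (G × H) ⧸ Γ))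
  interior_dense : Dense ((QuotientGroup.mk : G × H → (G × H) ⧸ Γ) '' interior F)

/-- The window `W` is large (with respect to `F`): it contains the projection of `F` to `H`. -/
def IsLargeWindow (F : Set (G × H)) (W : Set H) : Prop := Prod.snd '' F ⊆ W

/-- The homomorphism `Γ → Λ^∞` induced by the projection `G × H → G`, when `Λ` generates the
projection of `Γ`. (For a cut-and-project scheme it is then an isomorphism.) -/
def projection {Γ : Subgroup (G × H)} {Λ : Set G}
    (h : Subgroup.closure Λ = Γ.map (MonoidHom.fst G H)) : Γ →* Subgroup.closure Λ :=
  ((MonoidHom.fst G H).comp Γ.subtype).codRestrict (Subgroup.closure Λ)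
    (fun γ => h ▸ Subgroup.mem_map_of_mem (MonoidHom.fst G H) γ.2)

end CutAndProject

/-! ### Invariant measures and sections -/

/-- `ν` is a probability measure that is invariant under the action of `L`. -/
structure IsInvariantProbability (L : Type*) {X : Type*} [Group L] [MulAction L X]
    [MeasurableSpace X] (ν : Measure X) : Prop where
  isProbability : IsProbabilityMeasure ν
  map_smul : ∀ g : L, ν.map (fun x => g • x) = ν

/-- A bounded Borel section `σ` of the hull: `σ P ∈ P` for all `P` in the hull of `Λ`. -/
structure IsHullSection {G : Type*} [Group G] [TopologicalSpace G] [IsTopologicalGroup G]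
    [MeasurableSpace G] (Λ : Set G) (σ : hull Λ → G) : Prop where
  measurable : Measurable σ
  bounded : IsCompact (closure (Set.range σ))
  mem : ∀ P : hull Λ, σ P ∈ P.1.carrier

/-- A bounded Borel section `s` of the quotient map `L → L/Γ`. -/
structure IsQuotientSection {L : Type*} [Group L] [TopologicalSpace L] [MeasurableSpace L]
    (Γ : Subgroup L) (s : L ⧸ Γ → L) : Prop where
  measurable : Measurable s
  bounded : IsCompact (closure (Set.range s))
  mk_eq : ∀ y : L ⧸ Γ, (QuotientGroup.mk (s y) : L ⧸ Γ) = y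

/-! ### Affine `L^p`-actions and induction -/

/-- `E` is an `L^p`-space: it is isometrically isomorphic to `L^p(Ω, μ)` for a sigma-finite
measure `μ` on a standard Borel space `Ω`. -/
def IsLpSpace (p : ℝ≥0∞) [Fact (1 ≤ p)] (E : Type*) [NormedAddCommGroup E] [NormedSpace ℝ E] :
    Prop :=
  ∃ (Ω : Type) (_ : MeasurableSpace Ω) (_ : StandardBorelSpace Ω) (μ : Measure Ω)
    (_ : SigmaFinite μ), Nonempty (E ≃ₗᵢ[ℝ] Lp ℝ p μ)

/-- An affine isometric action `ρ = (π, b)` of a topological group `L` on `E` is an affine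
`L^p`-action if `E` is an `L^p`-space and `ρ` is continuous: the orbit maps of the linear part `π`
are continuous, and the cocycle `b(g) = ρ(g)0` is continuous. -/
structure IsAffineLpAction (p : ℝ≥0∞) [Fact (1 ≤ p)] {L E : Type*} [Group L] [TopologicalSpace L]
    [NormedAddCommGroup E] [NormedSpace ℝ E] (ρ : L →* (E ≃ᵃⁱ[ℝ] E)) : Prop where
  isLpSpace : IsLpSpace p E
  continuous_linear : ∀ v : E, Continuous fun g => (ρ g).linearIsometryEquiv v
  continuous_cocycle : Continuous fun g => ρ g 0

/-- Let `L` act on `(X, ν)` and let `s : X → L` be a section with associated cocycle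
`β(g, x) = s(gx)⁻¹ g s(x)`, so that `β(g⁻¹, x)⁻¹ = s(x)⁻¹ g s(g⁻¹x)`. The affine action `ρ'` of `L`
on `L^p(X, ν; E)` is `(ν, s)`-induced from the affine action `ρ = (π, b)` on `E` of the subgroup
`Δ` of `L` if, for each `g` and `f`, for almost all `x` the element `β(g⁻¹, x)⁻¹` lies in `Δ` and
`(ρ'(g) f)(x) = ρ(β(g⁻¹, x)⁻¹) (f(g⁻¹x)) = π(β(g⁻¹, x)⁻¹) (f(g⁻¹x)) + b(β(g⁻¹, x)⁻¹)`.
There is at most one such `ρ'`. -/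
def IsInduced {p : ℝ≥0∞} [Fact (1 ≤ p)] {L X E : Type*} [Group L] [MulAction L X]
    [MeasurableSpace X] [NormedAddCommGroup E] [NormedSpace ℝ E] (ν : Measure X) (s : X → L)
    {Δ : Subgroup L} (ρ : Δ →* (E ≃ᵃⁱ[ℝ] E)) (ρ' : L →* (Lp E p ν ≃ᵃⁱ[ℝ] Lp E p ν)) : Prop :=
  ∀ (g : L) (f : Lp E p ν), ∀ᵐ x ∂ν, ∃ l : Δ,
    (l : L) = (s x)⁻¹ * g * s (g⁻¹ • x) ∧ ρ' g f x = ρ l (f (g⁻¹ • x))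

/-- Two affine isometric actions of a group are isomorphic if they are intertwined by a bijective
affine isometry. -/
def AreIsomorphic {L E₁ E₂ : Type*} [Group L] [NormedAddCommGroup E₁] [NormedSpace ℝ E₁]
    [NormedAddCommGroup E₂] [NormedSpace ℝ E₂] (ρ₁ : L →* (E₁ ≃ᵃⁱ[ℝ] E₁))
    (ρ₂ : L →* (E₂ ≃ᵃⁱ[ℝ] E₂)) : Prop :=
  ∃ U : E₁ ≃ᵃⁱ[ℝ] E₂, ∀ (g : L) (v : E₁), U (ρ₁ g v) = ρ₂ g (U v)

end ModelSets

set_option linter.unusedSectionVars false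

namespace ModelSets

/-! ### Twisted composition operators on Bochner spaces -/

section Twist

variable {X Y Z E Γ : Type*} [MeasurableSpace X] [MeasurableSpace Y] [MeasurableSpace Z]
  {ν : Measure X} {m : Measure Y} {η : Measure Z}
  [NormedAddCommGroup E] [NormedSpace ℝ E] {p : ℝ≥0∞} [Group Γ]

/-! The hull of a regular model set is, up to null sets, the homogeneous space `Y = (G × H)/Γ`. A
closed set `P` in the hull determines a unique coset `y` whose slices satisfy `slice Γ (interior W)
y ⊆ P ⊆ slice Γ W y`. Existence follows from compactness of `Y`, since the relation is closed
(`isClosed_setOf_compatible`) and holds along the orbit of `Λ`. Uniqueness follows from density of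
the projection to `H`, injectivity of the projection to `G` and aperiodicity of `W`
(`Compatible.unique`). This gives a `G`-equivariant map `β` from the hull to `Y`. Over cosets that
avoid `G × ∂W` the two slices coincide, so there `β` has the inverse `Φ`, `y ↦ slice Γ W y`
(`exists_hullParametrization`).

The measures are controlled by lifting a `G`-invariant probability measure on `Y` to `G × H`. The
lift is left `G`-invariant, so it is Haar on `G` times some `η`; right `Γ`-invariance and density
make `η` right `H`-invariant, so the lift is a multiple of Haar measure (`lift_eq_smul_haar`). Thus
`Y` has only one `G`-invariant probability measure `m`, and it gives mass zero to the singular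
cosets because `∂W` is null. Every invariant `ν` on the hull is carried to `m` by `β`, so `ν` is the
image of `m` under `Φ`.

For the actions, `σ(P) ∈ P ⊆ slice Γ W (β P)` says that `(σ(P), b)` represents `β P` for some `b ∈
W`. Hence `s(y)⁻¹ (σ(Φ y), b)` is an element `c(y)` of `Γ`, and boundedness leaves only finitely
many values. The first coordinate of `c` conjugates the cocycle of `s`, restricted to `G`, into that
of `σ`, so `f ↦ (y ↦ κ(c(y)) f(Φ y))` is the intertwining isometry
(`HullParametrization.exists_affineIsometryEquiv`). Continuity is proved on `Y` and transported;
that the Bochner spaces are `L^p`-spaces is Fubini, `L^p(Y; L^p(Ω)) ≅ L^p(Y × Ω)`. -/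

theorem norm_affine_apply_le (A : E ≃ᵃⁱ[ℝ] E) (v : E) : ‖A v‖ ≤ ‖v‖ + ‖A 0‖ := by
  have h := A.dist_map v 0
  rw [dist_eq_norm, dist_zero_right] at h
  calc ‖A v‖ = ‖(A v - A 0) + A 0‖ := by simp
    _ ≤ ‖v‖ + ‖A 0‖ := (norm_add_le _ _).trans (by rw [h])

/-- On each of the finitely many fibres of `c` the twist is a fixed continuous map. -/
theorem aestronglyMeasurable_twist (κ : Γ →* (E ≃ᵃⁱ[ℝ] E)) (c : SimpleFunc Y Γ) {u : Y → E}
    (hu : AEStronglyMeasurable u m) : AEStronglyMeasurable (fun y => κ (c y) (u y)) m := by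
  classical
  have huniv : (⋃ γ : c.range, c ⁻¹' {(γ : Γ)}) = Set.univ := by
    ext y
    simp
  rw [← Measure.restrict_univ (μ := m), ← huniv, aestronglyMeasurable_iUnion_iff]
  rintro ⟨γ, -⟩
  have hγ : AEStronglyMeasurable (fun y => κ γ (u y)) (m.restrict (c ⁻¹' {γ})) :=
    (κ γ).continuous.comp_aestronglyMeasurable hu.restrict
  refine hγ.congr ?_
  filter_upwards [ae_restrict_mem (c.measurableSet_fiber γ)] with y hy
  rw [show c y = γ from hy]

theorem memLp_twist_of_memLp [IsFiniteMeasure m] (κ : Γ →* (E ≃ᵃⁱ[ℝ] E)) (c : SimpleFunc Y Γ)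
    {u : Y → E} (hu : MemLp u p m) : MemLp (fun y => κ (c y) (u y)) p m := by
  obtain ⟨C, hC⟩ : ∃ C : ℝ, ∀ γ ∈ c.range, ‖κ γ 0‖ ≤ C :=
    ⟨∑ γ ∈ c.range, ‖κ γ 0‖, fun γ hγ =>
      Finset.single_le_sum (f := fun γ => ‖κ γ 0‖) (fun _ _ => norm_nonneg _) hγ⟩
  have hb : MemLp (fun y => ‖u y‖ + C) p m := hu.norm.add (memLp_const C)
  refine hb.mono' (aestronglyMeasurable_twist κ c hu.1) (Filter.Eventually.of_forall fun y => ?_)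
  exact (norm_affine_apply_le _ _).trans (by gcongr; exact hC _ (c.mem_range_self y))

theorem memLp_twist [IsFiniteMeasure m] (κ : Γ →* (E ≃ᵃⁱ[ℝ] E)) (c : SimpleFunc Y Γ) {θ : Y → X}
    (hθ : MeasurePreserving θ m ν) (f : Lp E p ν) : MemLp (fun y => κ (c y) (f (θ y))) p m :=
  memLp_twist_of_memLp κ c ((Lp.memLp f).comp_measurePreserving hθ)

/-- The operator `f ↦ (y ↦ κ (c y) (f (θ y)))` between Bochner spaces. -/
noncomputable def twist [IsFiniteMeasure m] (κ : Γ →* (E ≃ᵃⁱ[ℝ] E)) (c : SimpleFunc Y Γ)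
    {θ : Y → X} (hθ : MeasurePreserving θ m ν) (f : Lp E p ν) : Lp E p m :=
  (memLp_twist κ c hθ f).toLp _

theorem coeFn_twist [IsFiniteMeasure m] (κ : Γ →* (E ≃ᵃⁱ[ℝ] E)) (c : SimpleFunc Y Γ) {θ : Y → X}
    (hθ : MeasurePreserving θ m ν) (f : Lp E p ν) :
    twist κ c hθ f =ᵐ[m] fun y => κ (c y) (f (θ y)) :=
  MemLp.coeFn_toLp _

theorem isometry_twist [Fact (1 ≤ p)] [IsFiniteMeasure m] (κ : Γ →* (E ≃ᵃⁱ[ℝ] E))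
    (c : SimpleFunc Y Γ) {θ : Y → X} (hθ : MeasurePreserving θ m ν) :
    Isometry (twist κ c hθ : Lp E p ν → Lp E p m) := by
  intro f g
  rw [Lp.edist_def, Lp.edist_def, ← eLpNorm_comp_measurePreserving
    ((Lp.aestronglyMeasurable f).sub (Lp.aestronglyMeasurable g)) hθ]
  refine eLpNorm_congr_norm_ae ?_
  filter_upwards [coeFn_twist κ c hθ f, coeFn_twist κ c hθ g] with y hf hg
  simp only [Pi.sub_apply, Function.comp_apply, hf, hg]
  rw [← dist_eq_norm, ← dist_eq_norm, (κ (c y)).dist_map]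

/-- Invertibility, multiplicativity and the intertwining relation are all instances of this
composition law. Its hypotheses are needed only almost everywhere, which is what allows maps
invertible off a null set. -/
theorem twist_twist [IsFiniteMeasure m] [IsFiniteMeasure ν] (κ : Γ →* (E ≃ᵃⁱ[ℝ] E))
    {c : SimpleFunc Y Γ} {c' : SimpleFunc X Γ} {c'' : SimpleFunc Y Γ}
    {θ : Y → X} {θ' : X → Z} {θ'' : Y → Z} (hθ : MeasurePreserving θ m ν)
    (hθ' : MeasurePreserving θ' ν η) (hθ'' : MeasurePreserving θ'' m η)
    (hc : ∀ᵐ y ∂m, c'' y = c y * c' (θ y)) (h : ∀ᵐ y ∂m, θ'' y = θ' (θ y)) (f : Lp E p η) :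
    twist κ c hθ (twist κ c' hθ' f) = twist κ c'' hθ'' f := by
  refine Lp.ext ?_
  filter_upwards [coeFn_twist κ c hθ (twist κ c' hθ' f), coeFn_twist κ c'' hθ'' f,
    hθ.quasiMeasurePreserving.ae_eq_comp (coeFn_twist κ c' hθ' f), hc, h] with y h₁ h₂ h₃ h₄ h₅
  simp only [Function.comp_apply] at h₃
  rw [h₁, h₂, h₃, h₄, h₅, map_mul]
  rfl

theorem twist_eq_self [IsFiniteMeasure ν] (κ : Γ →* (E ≃ᵃⁱ[ℝ] E))
    {c : SimpleFunc X Γ} {θ : X → X} (hθ : MeasurePreserving θ ν ν)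
    (hc : ∀ᵐ x ∂ν, c x = 1) (h : ∀ᵐ x ∂ν, θ x = x) (f : Lp E p ν) :
    twist κ c hθ f = f := by
  refine Lp.ext ?_
  filter_upwards [coeFn_twist κ c hθ f, hc, h] with x h₁ h₂ h₃
  rw [h₁, h₂, h₃, map_one]
  rfl

/-- A twisted composition operator with almost everywhere invertible data is a bijective affine
isometry. -/
noncomputable def twistEquiv [Fact (1 ≤ p)] [IsFiniteMeasure m] [IsFiniteMeasure ν]
    (κ : Γ →* (E ≃ᵃⁱ[ℝ] E)) (c : SimpleFunc Y Γ) (c' : SimpleFunc X Γ) {θ : Y → X} {θ' : X → Y}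
    (hθ : MeasurePreserving θ m ν) (hθ' : MeasurePreserving θ' ν m)
    (h₁ : ∀ᵐ y ∂m, θ' (θ y) = y) (h₂ : ∀ᵐ x ∂ν, θ (θ' x) = x)
    (h₃ : ∀ᵐ y ∂m, c y * c' (θ y) = 1) (h₄ : ∀ᵐ x ∂ν, c' x * c (θ' x) = 1) :
    Lp E p ν ≃ᵃⁱ[ℝ] Lp E p m :=
  -- Mazur–Ulam: a bijective isometry of real normed spaces is affine, so affinity need not be
  -- checked.
  IsometryEquiv.toRealAffineIsometryEquiv
    { toFun := twist κ c hθ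
      invFun := twist κ c' hθ'
      left_inv := fun f => by
        rw [twist_twist κ (c'' := 1) hθ' hθ (MeasurePreserving.id ν)
          (h₄.mono fun _ h => h.symm) (h₂.mono fun _ h => h.symm)]
        exact twist_eq_self κ _ (by simp) (by simp) f
      right_inv := fun f => by
        rw [twist_twist κ (c'' := 1) hθ hθ' (MeasurePreserving.id m)
          (h₃.mono fun _ h => h.symm) (h₁.mono fun _ h => h.symm)]
        exact twist_eq_self κ _ (by simp) (by simp) f
      isometry_toFun := isometry_twist κ c hθ }

theorem twistEquiv_apply [Fact (1 ≤ p)] [IsFiniteMeasure m] [IsFiniteMeasure ν]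
    (κ : Γ →* (E ≃ᵃⁱ[ℝ] E)) (c : SimpleFunc Y Γ) (c' : SimpleFunc X Γ) {θ : Y → X} {θ' : X → Y}
    (hθ : MeasurePreserving θ m ν) (hθ' : MeasurePreserving θ' ν m)
    (h₁ : ∀ᵐ y ∂m, θ' (θ y) = y) (h₂ : ∀ᵐ x ∂ν, θ (θ' x) = x)
    (h₃ : ∀ᵐ y ∂m, c y * c' (θ y) = 1) (h₄ : ∀ᵐ x ∂ν, c' x * c (θ' x) = 1) (f : Lp E p ν) :
    twistEquiv κ c c' hθ hθ' h₁ h₂ h₃ h₄ f = twist κ c hθ f := rfl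

theorem twistEquiv_symm_apply [Fact (1 ≤ p)] [IsFiniteMeasure m] [IsFiniteMeasure ν]
    (κ : Γ →* (E ≃ᵃⁱ[ℝ] E)) (c : SimpleFunc Y Γ) (c' : SimpleFunc X Γ) {θ : Y → X} {θ' : X → Y}
    (hθ : MeasurePreserving θ m ν) (hθ' : MeasurePreserving θ' ν m)
    (h₁ : ∀ᵐ y ∂m, θ' (θ y) = y) (h₂ : ∀ᵐ x ∂ν, θ (θ' x) = x)
    (h₃ : ∀ᵐ y ∂m, c y * c' (θ y) = 1) (h₄ : ∀ᵐ x ∂ν, c' x * c (θ' x) = 1) (f : Lp E p m) :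
    (twistEquiv κ c c' hθ hθ' h₁ h₂ h₃ h₄).symm f = twist κ c' hθ' f := by
  apply (twistEquiv κ c c' hθ hθ' h₁ h₂ h₃ h₄).injective
  rw [AffineIsometryEquiv.apply_symm_apply, twistEquiv_apply,
    twist_twist κ (c'' := 1) hθ hθ' (MeasurePreserving.id m)
      (h₃.mono fun _ h => h.symm) (h₁.mono fun _ h => h.symm)]
  exact (twist_eq_self κ _ (by simp) (by simp) f).symm

section Action

variable {L : Type*} [Group L] [MulAction L X]

/-- The affine isometric action on `L^p(X, ν; E)` defined by a measure-preserving action on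
`(X, ν)` and a cocycle `c` (in the form `c (g * h) x = c g x * c h (g⁻¹ • x)`) with finitely many
values for each `g`. -/
noncomputable def cocycleAction [Fact (1 ≤ p)] [IsFiniteMeasure ν] (κ : Γ →* (E ≃ᵃⁱ[ℝ] E))
    (c : L → SimpleFunc X Γ) (hL : ∀ g : L, MeasurePreserving (fun x : X => g • x) ν ν)
    (hc : ∀ g h x, c (g * h) x = c g x * c h (g⁻¹ • x)) :
    L →* (Lp E p ν ≃ᵃⁱ[ℝ] Lp E p ν) where
  toFun g :=
    have hone (x : X) : c 1 x = 1 := by simpa using hc 1 1 x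
    twistEquiv κ (c g) (c g⁻¹) (hL g⁻¹) (inv_inv g ▸ hL g⁻¹⁻¹)
      (by simp) (by simp)
      (Filter.Eventually.of_forall fun x => by rw [← hc, mul_inv_cancel, hone])
      (Filter.Eventually.of_forall fun x => by
        simpa [hone] using (hc g⁻¹ g x).symm)
  map_one' := by
    have hone (x : X) : c 1 x = 1 := by simpa using hc 1 1 x
    ext1 f
    rw [twistEquiv_apply]
    exact twist_eq_self κ _ (by simp [hone]) (by simp) f
  map_mul' g h := by
    ext1 f
    exact (twist_twist κ (hL g⁻¹) (hL h⁻¹) (hL (g * h)⁻¹) (Filter.Eventually.of_forall (hc g h))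
      (Filter.Eventually.of_forall fun x => by simp [mul_smul]) f).symm

end Action

end Twist

/-! ### Bochner spaces of functions with values in an `L^p`-space -/

section BochnerLp

/-- By second countability (Lindelöf) every open set is a countable union of balls, and preimages of
balls are governed by the distance functions. -/
theorem measurable_of_measurable_edist {Y M : Type*} [MeasurableSpace Y] [PseudoEMetricSpace M]
    [SecondCountableTopology M] [MeasurableSpace M] [BorelSpace M] {u : Y → M}
    (hu : ∀ v, Measurable fun y => edist (u y) v) : Measurable u := by
  refine measurable_of_isOpen fun U hU => ?_
  choose! ε hε hεU using fun x (hx : x ∈ U) => EMetric.isOpen_iff.1 hU x hx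
  obtain ⟨T, -, hT, hTe⟩ := TopologicalSpace.isOpen_biUnion_countable U
    (fun x => Metric.eball x (ε x)) (fun _ _ => Metric.isOpen_eball)
  have hUe : U = ⋃ x ∈ T, Metric.eball x (ε x) := by
    rw [hTe]
    refine Set.Subset.antisymm (fun x hx => ?_) (Set.iUnion₂_subset hεU)
    exact Set.mem_iUnion₂.2 ⟨x, hx, Metric.mem_eball_self (hε x hx)⟩
  rw [hUe, Set.preimage_iUnion₂]
  refine MeasurableSet.biUnion hT fun x _ => ?_
  exact measurableSet_lt (hu x) measurable_const

variable {p : ℝ≥0∞} [Fact (1 ≤ p)] {Y Ω E : Type*} [MeasurableSpace Y] [MeasurableSpace Ω]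
  {m : Measure Y} {μ : Measure Ω} [NormedAddCommGroup E] [NormedSpace ℝ E]

theorem eLpNorm_pow_toReal {α F : Type*} [MeasurableSpace α] [NormedAddCommGroup F]
    {η : Measure α} (hp : p ≠ ∞) (u : α → F) :
    eLpNorm u p η ^ p.toReal = ∫⁻ a, ‖u a‖ₑ ^ p.toReal ∂η := by
  have hp0 : p ≠ 0 := (zero_lt_one.trans_le (Fact.out : 1 ≤ p)).ne'
  rw [eLpNorm_eq_lintegral_rpow_enorm_toReal hp0 hp, ← ENNReal.rpow_mul,
    one_div_mul_cancel (ENNReal.toReal_pos hp0 hp).ne', ENNReal.rpow_one]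

/-- The function `u : Y → E` corresponds to the function `F` on `Y × Ω` under the isometry
`e : E ≃ L^p(Ω, μ)`. -/
def Represents (e : E ≃ₗᵢ[ℝ] Lp ℝ p μ) (m : Measure Y) (u : Y → E) (F : Y × Ω → ℝ) : Prop :=
  ∀ᵐ y ∂m, e (u y) =ᵐ[μ] fun ω => F (y, ω)

/-- Tonelli. Applied to differences it makes the passage between `u` and `F` isometric. -/
theorem Represents.eLpNorm_eq [SFinite μ] {e : E ≃ₗᵢ[ℝ] Lp ℝ p μ} (hp : p ≠ ∞) {u : Y → E}
    {F : Y × Ω → ℝ} (h : Represents e m u F) (hF : AEStronglyMeasurable F (m.prod μ)) :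
    eLpNorm F p (m.prod μ) = eLpNorm u p m := by
  have hp0 : p ≠ 0 := (zero_lt_one.trans_le (Fact.out : 1 ≤ p)).ne'
  refine ENNReal.rpow_left_injective (ENNReal.toReal_pos hp0 hp).ne' ?_
  simp only [eLpNorm_pow_toReal hp]
  rw [lintegral_prod _ (hF.enorm.pow_const _)]
  refine lintegral_congr_ae ?_
  filter_upwards [h] with y hy
  rw [← eLpNorm_pow_toReal hp (fun ω => F (y, ω)), ← eLpNorm_congr_ae hy, ← Lp.enorm_def,
    e.enorm_map]

theorem Represents.sub {e : E ≃ₗᵢ[ℝ] Lp ℝ p μ} {u v : Y → E} {F K : Y × Ω → ℝ}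
    (h : Represents e m u F) (h' : Represents e m v K) : Represents e m (u - v) (F - K) := by
  filter_upwards [h, h'] with y hy hy'
  rw [Pi.sub_apply, map_sub]
  filter_upwards [hy, hy', Lp.coeFn_sub (e (u y)) (e (v y))] with ω h₁ h₂ h₃
  rw [h₃, Pi.sub_apply, Pi.sub_apply, h₁, h₂]

theorem Represents.add {e : E ≃ₗᵢ[ℝ] Lp ℝ p μ} {u v : Y → E} {F K : Y × Ω → ℝ}
    (h : Represents e m u F) (h' : Represents e m v K) : Represents e m (u + v) (F + K) := by
  filter_upwards [h, h'] with y hy hy'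
  rw [Pi.add_apply, map_add]
  filter_upwards [hy, hy', Lp.coeFn_add (e (u y)) (e (v y))] with ω h₁ h₂ h₃
  rw [h₃, Pi.add_apply, Pi.add_apply, h₁, h₂]

theorem Represents.congr [SFinite μ] {e : E ≃ₗᵢ[ℝ] Lp ℝ p μ} {u v : Y → E} {F K : Y × Ω → ℝ}
    (h : Represents e m u F) (huv : u =ᵐ[m] v) (hFK : F =ᵐ[m.prod μ] K) :
    Represents e m v K := by
  filter_upwards [h, huv, Measure.ae_ae_of_ae_prod hFK] with y hy hy' hy''
  rw [← hy']
  exact hy.trans hy''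

theorem Represents.edist_eq [SFinite μ] {e : E ≃ₗᵢ[ℝ] Lp ℝ p μ} (hp : p ≠ ∞) {u v : Lp E p m}
    {F K : Lp ℝ p (m.prod μ)} (h : Represents e m u F) (h' : Represents e m v K) :
    edist u v = edist F K := by
  rw [Lp.edist_def, Lp.edist_def]
  exact ((h.sub h').eLpNorm_eq hp
    ((Lp.aestronglyMeasurable F).sub (Lp.aestronglyMeasurable K))).symm

/-- Take `u(y)` to be the class of `F(y, ·)`, which lies in `L^p` for almost every `y` by Tonelli.
Since `L^p(Ω)` is separable, measurability of `u` can be tested on distances to fixed vectors, and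
these are parametric integrals. -/
theorem exists_represents [SFinite μ] [SecondCountableTopology (Lp ℝ p μ)]
    (e : E ≃ₗᵢ[ℝ] Lp ℝ p μ) (hp : p ≠ ∞) (F : Lp ℝ p (m.prod μ)) :
    ∃ u : Lp E p m, Represents e m u F := by
  classical
  have hp0 : p ≠ 0 := (zero_lt_one.trans_le (Fact.out : 1 ≤ p)).ne'
  have hppos := ENNReal.toReal_pos hp0 hp
  have hFm : Measurable F := (Lp.stronglyMeasurable F).measurable
  have hFy (y : Y) : Measurable fun ω => F (y, ω) := hFm.comp measurable_prodMk_left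
  have hmem (y : Y) : MemLp (fun ω => F (y, ω)) p μ ↔ ∫⁻ ω, ‖F (y, ω)‖ₑ ^ p.toReal ∂μ < ∞ := by
    rw [← eLpNorm_pow_toReal hp (fun ω => F (y, ω)), ENNReal.rpow_lt_top_iff_of_pos hppos]
    exact ⟨fun h => h.2, fun h => ⟨(hFy y).aestronglyMeasurable, h⟩⟩
  have hset : MeasurableSet {y : Y | MemLp (fun ω => F (y, ω)) p μ} := by
    simp only [hmem]
    exact measurableSet_lt (Measurable.lintegral_prod_right' (hFm.enorm.pow_const _))
      measurable_const
  -- The value `0` is used only on the null set of `y` whose section is not in `L^p`.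
  set w : Y → Lp ℝ p μ := fun y =>
    if h : MemLp (fun ω => F (y, ω)) p μ then h.toLp _ else 0 with hw
  let _ : MeasurableSpace (Lp ℝ p μ) := borel _
  have : BorelSpace (Lp ℝ p μ) := ⟨rfl⟩
  have hwm : Measurable w := by
    refine measurable_of_measurable_edist fun v => ?_
    have hv : (fun y => edist (w y) v) = fun y =>
        if MemLp (fun ω => F (y, ω)) p μ then
          (∫⁻ ω, ‖F (y, ω) - v ω‖ₑ ^ p.toReal ∂μ) ^ (1 / p.toReal) else edist 0 v := by
      funext y
      by_cases h : MemLp (fun ω => F (y, ω)) p μ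
      · simp only [hw, dif_pos h, if_pos h]
        rw [Lp.edist_def, eLpNorm_eq_lintegral_rpow_enorm_toReal hp0 hp]
        congr 1
        refine lintegral_congr_ae ?_
        filter_upwards [h.coeFn_toLp] with ω hω
        rw [Pi.sub_apply, hω]
      · simp only [hw, dif_neg h, if_neg h]
    rw [hv]
    refine Measurable.ite hset (Measurable.pow_const ?_ _) measurable_const
    refine Measurable.lintegral_prod_right' (f := fun z : Y × Ω => ‖F z - v z.2‖ₑ ^ p.toReal) ?_
    exact (hFm.sub ((Lp.stronglyMeasurable v).measurable.comp measurable_snd)).enorm.pow_const _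
  have hae : ∀ᵐ y ∂m, MemLp (fun ω => F (y, ω)) p μ := by
    simp only [hmem]
    refine ae_lt_top (Measurable.lintegral_prod_right' (hFm.enorm.pow_const _)) ?_
    rw [← lintegral_prod _ (hFm.enorm.pow_const _).aemeasurable, ← eLpNorm_pow_toReal hp]
    exact (ENNReal.rpow_lt_top_of_nonneg hppos.le (Lp.eLpNorm_ne_top F)).ne
  have hrep : Represents e m (fun y => e.symm (w y)) F := by
    filter_upwards [hae] with y hy
    simp only [hw, dif_pos hy, LinearIsometryEquiv.apply_symm_apply]
    exact hy.coeFn_toLp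
  have hmemLp : MemLp (fun y => e.symm (w y)) p m :=
    ⟨(e.symm.continuous.comp_stronglyMeasurable hwm.stronglyMeasurable).aestronglyMeasurable,
      hrep.eLpNorm_eq hp (Lp.aestronglyMeasurable F) ▸ Lp.eLpNorm_lt_top F⟩
  exact ⟨hmemLp.toLp _, hrep.congr hmemLp.coeFn_toLp.symm .rfl⟩

/-- The isometry `J` has closed range. The range is closed under the sums needed in the induction
and contains the indicator functions with values in `E`, so density of simple functions makes `J`
onto. -/
theorem nonempty_affineIsometryEquiv_prod [SFinite μ] [SecondCountableTopology (Lp ℝ p μ)]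
    [CompleteSpace E] (e : E ≃ₗᵢ[ℝ] Lp ℝ p μ) (hp : p ≠ ∞) :
    Nonempty (Lp E p m ≃ₗᵢ[ℝ] Lp ℝ p (m.prod μ)) := by
  choose J hJ using exists_represents (m := m) e hp
  have hiso : Isometry J := fun F K => (hJ F).edist_eq hp (hJ K)
  have hrange {u : Lp E p m} {F : Y × Ω → ℝ} (h : Represents e m u F)
      (hF : AEStronglyMeasurable F (m.prod μ)) : u ∈ Set.range J := by
    have hFm : MemLp F p (m.prod μ) := ⟨hF, h.eLpNorm_eq hp hF ▸ Lp.eLpNorm_lt_top u⟩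
    refine ⟨hFm.toLp F, ?_⟩
    rw [← edist_eq_zero, (hJ _).edist_eq hp (h.congr .rfl hFm.coeFn_toLp.symm), edist_self]
  have hsurj : Function.Surjective J := by
    intro u
    change u ∈ Set.range J
    induction u using Lp.induction hp with
    | indicatorConst v hs hsm =>
      rename_i s
      -- The function `1_s · v` on `Y` corresponds to `1_s ⊗ e(v)` on `Y × Ω`.
      refine hrange (F := fun z => s.indicator (fun _ => (1 : ℝ)) z.1 * e v z.2) ?_ ?_
      · rw [Lp.simpleFunc.coe_indicatorConst]
        filter_upwards [indicatorConstLp_coeFn (p := p) (hs := hs) (hμs := hsm.ne) (c := v)]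
          with y hy
        rw [hy]
        by_cases hys : y ∈ s
        · simp [hys]
        · simp only [hys, not_false_eq_true, Set.indicator_of_notMem, map_zero, zero_mul]
          exact Lp.coeFn_zero ..
      · exact (((measurable_const.indicator hs).comp measurable_fst).mul
          ((Lp.stronglyMeasurable (e v)).measurable.comp measurable_snd)).aestronglyMeasurable
    | add hf hg _ ihf ihg =>
      obtain ⟨F, hF⟩ := ihf
      obtain ⟨K, hK⟩ := ihg
      refine hrange (F := F + K) ?_
        ((Lp.aestronglyMeasurable F).add (Lp.aestronglyMeasurable K))
      exact ((hF ▸ hJ F).add (hK ▸ hJ K)).congr (Lp.coeFn_add _ _).symm .rfl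
    | isClosed => exact hiso.isClosedEmbedding.isClosed_range
  -- `J` is chosen pointwise and not known to be linear; Mazur–Ulam makes it affine, and its linear
  -- part is the required isometry.
  exact ⟨((IsometryEquiv.mk (Equiv.ofBijective J ⟨hiso.injective, hsurj⟩)
    hiso).toRealAffineIsometryEquiv.linearIsometryEquiv).symm⟩

theorem IsLpSpace.lp_of_type_zero {Y : Type} [MeasurableSpace Y] [StandardBorelSpace Y]
    (m : Measure Y) [IsFiniteMeasure m] (hp : p ≠ ∞) (hE : IsLpSpace p E) :
    IsLpSpace p (Lp E p m) := by
  obtain ⟨Ω, _, _, μ, _, ⟨e⟩⟩ := hE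
  have : Fact (p ≠ ∞) := ⟨hp⟩
  have : CompleteSpace E := e.toIsometryEquiv.completeSpace
  exact ⟨Y × Ω, inferInstance, inferInstance, m.prod μ, inferInstance,
    nonempty_affineIsometryEquiv_prod e hp⟩

theorem IsLpSpace.of_affineIsometryEquiv {E' : Type*} [NormedAddCommGroup E'] [NormedSpace ℝ E']
    (hE : IsLpSpace p E) (A : E' ≃ᵃⁱ[ℝ] E) : IsLpSpace p E' := by
  obtain ⟨Ω, h₁, h₂, μ, h₃, ⟨e⟩⟩ := hE
  exact ⟨Ω, h₁, h₂, μ, h₃, ⟨A.linearIsometryEquiv.trans e⟩⟩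

/-- `IsLpSpace` asks for a base space in `Type`. A standard Borel `Y` in any universe embeds
measurably in `ℝ`, so `m` is replaced by its image there, using a twist by the trivial group. -/
theorem IsLpSpace.lp [StandardBorelSpace Y] [Nonempty Y] (m : Measure Y) [IsFiniteMeasure m]
    (hp : p ≠ ∞) (hE : IsLpSpace p E) : IsLpSpace p (Lp E p m) := by
  have hι := measurableEmbedding_embeddingReal Y
  obtain ⟨r, hr, hrι⟩ := hι.exists_measurable_extend measurable_id fun _ => inferInstance
  have hrι' (y : Y) : r (embeddingReal Y y) = y := congrFun hrι y
  have hmp : MeasurePreserving (embeddingReal Y) m (m.map (embeddingReal Y)) :=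
    hι.measurable.measurePreserving m
  have hmp' : MeasurePreserving r (m.map (embeddingReal Y)) m :=
    ⟨hr, by rw [Measure.map_map hr hι.measurable, hrι, Measure.map_id]⟩
  refine (hE.lp_of_type_zero (m.map (embeddingReal Y)) hp).of_affineIsometryEquiv
    (twistEquiv (1 : Unit →* (E ≃ᵃⁱ[ℝ] E)) 1 1 hmp' hmp ?_ ?_ ?_ ?_)
  · exact hι.ae_map_iff.2 (by simp [hrι'])
  all_goals simp [hrι']

end BochnerLp

/-! ### Quotients by uniform lattices -/

/-- Glues finitely many local measurable maps by priority; it produces the bounded Borel sections of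
both the quotient and the hull. -/
theorem exists_measurable_selection {X M ι : Type*} [MeasurableSpace X] [MeasurableSpace M]
    (A : ι → Set X) (u : ι → X → M) (hA : ∀ i, MeasurableSet (A i)) (hu : ∀ i, Measurable (u i))
    (t : Finset ι) (ht : t.Nonempty) (hcover : ∀ x, ∃ i ∈ t, x ∈ A i) :
    ∃ f : X → M, Measurable f ∧ ∀ x, ∃ i ∈ t, x ∈ A i ∧ f x = u i x := by
  classical
  suffices H : ∀ t : Finset ι, t.Nonempty →
      ∃ f : X → M, Measurable f ∧ ∀ x, (∃ i ∈ t, x ∈ A i) → ∃ i ∈ t, x ∈ A i ∧ f x = u i x by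
    obtain ⟨f, hf, h⟩ := H t ht
    exact ⟨f, hf, fun x => h x (hcover x)⟩
  intro t ht
  induction ht using Finset.Nonempty.cons_induction with
  | singleton i =>
    refine ⟨u i, hu i, ?_⟩
    rintro x ⟨j, hj, hx⟩
    rw [Finset.mem_singleton.1 hj] at hx
    exact ⟨i, Finset.mem_singleton_self i, hx, rfl⟩
  | cons i t hi ht ih =>
    obtain ⟨f, hf, h⟩ := ih
    refine ⟨(A i).piecewise (u i) f, (hu i).piecewise (hA i) hf, ?_⟩
    rintro x ⟨j, hj, hx⟩
    by_cases hxi : x ∈ A i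
    · exact ⟨i, Finset.mem_cons_self i t, hxi, Set.piecewise_eq_of_mem _ _ _ hxi⟩
    · have hjt : j ∈ t := by
        rcases Finset.mem_cons.1 hj with rfl | hj
        exacts [absurd hx hxi, hj]
      obtain ⟨k, hk, hxk, hfk⟩ := h x ⟨j, hjt, hx⟩
      exact ⟨k, Finset.mem_cons_of_mem hk, hxk,
        (Set.piecewise_eq_of_notMem _ _ _ hxi).trans hfk⟩

section Lattice

variable {L : Type*} [Group L] [TopologicalSpace L] [IsTopologicalGroup L] [T2Space L]

/-- A discrete subgroup is closed, so the intersection is compact and discrete. This is why the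
cocycles of bounded sections take finitely many values. -/
theorem finite_inter_of_isCompact (Γ : Subgroup L) [DiscreteTopology Γ] {K : Set L}
    (hK : IsCompact K) : ((Γ : Set L) ∩ K).Finite := by
  have hcl : IsClosed (Γ : Set L) := Subgroup.isClosed_of_discrete
  refine (hK.inter_left hcl).finite ?_
  have hd : IsDiscrete (Γ : Set L) := ⟨inferInstanceAs (DiscreteTopology Γ)⟩
  exact hd.mono Set.inter_subset_left

theorem t2Space_quotient_of_discrete (Γ : Subgroup L) [DiscreteTopology Γ] : T2Space (L ⧸ Γ) := by
  rw [t2Space_iff_of_isOpenQuotientMap QuotientGroup.isOpenQuotientMap_mk]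
  have hcl : IsClosed (Γ : Set L) := Subgroup.isClosed_of_discrete
  have h : {q : L × L | (QuotientGroup.mk q.1 : L ⧸ Γ) = QuotientGroup.mk q.2} =
      (fun q : L × L => q.1⁻¹ * q.2) ⁻¹' (Γ : Set L) := by
    ext q
    exact QuotientGroup.eq
  rw [h]
  exact hcl.preimage (by fun_prop)

theorem countable_of_discrete [SecondCountableTopology L] (Γ : Subgroup L) [DiscreteTopology Γ] :
    Countable Γ :=
  TopologicalSpace.separableSpace_iff_countable.1 inferInstance

variable [LocallyCompactSpace L]

/-- Continuity of `(a, b) ↦ a⁻¹b` at the identity, applied to a neighbourhood meeting `Γ` only in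
`1`. -/
theorem exists_isOpen_injOn_mk (Γ : Subgroup L) [DiscreteTopology Γ] :
    ∃ U : Set L, IsOpen U ∧ 1 ∈ U ∧ IsCompact (closure U) ∧
      ∀ a ∈ U, ∀ b ∈ U, a⁻¹ * b ∈ Γ → a = b := by
  obtain ⟨N, hN, hNΓ⟩ : ∃ N : Set L, IsOpen N ∧ N ∩ Γ = {1} := by
    have hd : IsDiscrete (Γ : Set L) := ⟨inferInstanceAs (DiscreteTopology Γ)⟩
    exact (isDiscrete_iff_forall_mem_exists_isOpen.1 hd) 1 Γ.one_mem
  have h1 : (1 : L) ∈ N := (hNΓ.ge rfl).1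
  have hcont : Continuous fun q : L × L => q.1⁻¹ * q.2 := by fun_prop
  have hpre : (fun q : L × L => q.1⁻¹ * q.2) ⁻¹' N ∈ nhds ((1 : L), (1 : L)) :=
    (hN.preimage hcont).mem_nhds (by simpa using h1)
  rw [nhds_prod_eq] at hpre
  obtain ⟨V, hV, hVN⟩ := Filter.mem_prod_same_iff.1 hpre
  obtain ⟨K, hK, hKV⟩ := exists_compact_mem_nhds (1 : L)
  refine ⟨interior (V ∩ K), isOpen_interior,
    mem_interior_iff_mem_nhds.2 (Filter.inter_mem hV hKV),
    hK.closure_of_subset (interior_subset.trans Set.inter_subset_right), ?_⟩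
  intro a ha b hb hab
  have hmem : a⁻¹ * b ∈ N ∩ Γ :=
    ⟨hVN (Set.mk_mem_prod (interior_subset ha).1 (interior_subset hb).1), hab⟩
  rw [hNΓ] at hmem
  exact inv_mul_eq_one.1 hmem

theorem isOpenEmbedding_mk_mul {Γ : Subgroup L} {U : Set L} (hU : IsOpen U)
    (hinj : ∀ a ∈ U, ∀ b ∈ U, a⁻¹ * b ∈ Γ → a = b) (x : L) :
    Topology.IsOpenEmbedding (fun u : U => (QuotientGroup.mk (x * u) : L ⧸ Γ)) := by
  refine .of_continuous_injective_isOpenMap ?_ ?_ ?_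
  · exact QuotientGroup.continuous_mk.comp (by fun_prop)
  · intro a b hab
    refine Subtype.ext (hinj a a.2 b b.2 ?_)
    have h := QuotientGroup.eq.1 hab
    rwa [mul_inv_rev, mul_assoc, inv_mul_cancel_left] at h
  · exact QuotientGroup.isOpenMap_coe.comp
      ((isOpenMap_mul_left x).comp hU.isOpenMap_subtype_val)

theorem exists_finset_cover_quotient (Γ : Subgroup L) [CompactSpace (L ⧸ Γ)] {U : Set L}
    (hU : IsOpen U) (h1 : 1 ∈ U) :
    ∃ t : Finset L, t.Nonempty ∧
      ∀ y : L ⧸ Γ, ∃ x ∈ t, ∃ u : U, (QuotientGroup.mk (x * u) : L ⧸ Γ) = y := by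
  obtain ⟨t, ht⟩ := isCompact_univ.elim_finite_subcover
    (fun x : L => Set.range fun u : U => (QuotientGroup.mk (x * u) : L ⧸ Γ))
    (fun x => (QuotientGroup.isOpenMap_coe.comp
      ((isOpenMap_mul_left x).comp hU.isOpenMap_subtype_val)).isOpen_range)
    (fun y _ => by
      obtain ⟨x, rfl⟩ := QuotientGroup.mk_surjective y
      exact Set.mem_iUnion.2 ⟨x, ⟨1, h1⟩, by simp⟩)
  have hcover (y : L ⧸ Γ) : ∃ x ∈ t, ∃ u : U, (QuotientGroup.mk (x * u) : L ⧸ Γ) = y := by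
    simpa using ht (Set.mem_univ y)
  obtain ⟨x, hx, -⟩ := hcover (QuotientGroup.mk 1)
  exact ⟨t, ⟨x, hx⟩, hcover⟩

variable [SecondCountableTopology L] [MeasurableSpace L] [BorelSpace L]

/-- The quotient carries the finest sigma-algebra making the projection measurable. A set in it is a
finite union of images of Borel sets under the open embeddings `u ↦ xuΓ`, hence Borel. -/
theorem borelSpace_quotient_of_discrete (Γ : Subgroup L) [DiscreteTopology Γ]
    [CompactSpace (L ⧸ Γ)] : BorelSpace (L ⧸ Γ) := by
  constructor
  apply le_antisymm
  · intro A hA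
    have hA' : MeasurableSet ((QuotientGroup.mk : L → L ⧸ Γ) ⁻¹' A) := hA
    obtain ⟨U, hU, h1, -, hinj⟩ := exists_isOpen_injOn_mk Γ
    obtain ⟨t, -, ht⟩ := exists_finset_cover_quotient Γ hU h1
    let _ : MeasurableSpace (L ⧸ Γ) := borel _
    have : BorelSpace (L ⧸ Γ) := ⟨rfl⟩
    have hAe : A = ⋃ x ∈ t, (fun u : U => (QuotientGroup.mk (x * u) : L ⧸ Γ)) ''
        ((fun u : U => x * (u : L)) ⁻¹' ((QuotientGroup.mk : L → L ⧸ Γ) ⁻¹' A)) := by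
      ext y
      simp only [Set.mem_iUnion, Set.mem_image, Set.mem_preimage]
      constructor
      · intro hy
        obtain ⟨x, hx, u, rfl⟩ := ht y
        exact ⟨x, hx, u, hy, rfl⟩
      · rintro ⟨x, -, u, hu, rfl⟩
        exact hu
    change MeasurableSet A
    rw [hAe]
    refine t.measurableSet_biUnion fun x _ => ?_
    refine (isOpenEmbedding_mk_mul hU hinj x).measurableEmbedding.measurableSet_image.2 ?_
    exact (measurable_subtype_coe.const_mul x) hA'
  · refine MeasurableSpace.generateFrom_le fun V hV => ?_
    exact (IsOpen.preimage QuotientGroup.continuous_mk hV).measurableSet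

/-- The inverses of finitely many embeddings `u ↦ xuΓ`, with `u` in a relatively compact
neighbourhood of `1`, are glued. -/
theorem exists_isQuotientSection (Γ : Subgroup L) [DiscreteTopology Γ] [CompactSpace (L ⧸ Γ)] :
    ∃ s : L ⧸ Γ → L, IsQuotientSection Γ s := by
  have := borelSpace_quotient_of_discrete Γ
  obtain ⟨U, hU, h1, hcpt, hinj⟩ := exists_isOpen_injOn_mk Γ
  obtain ⟨t, htne, ht⟩ := exists_finset_cover_quotient Γ hU h1
  have hemb (x : L) := isOpenEmbedding_mk_mul hU hinj x
  choose u hum hu using fun x : L => (hemb x).measurableEmbedding.exists_measurable_extend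
    (measurable_subtype_coe.const_mul x) (fun _ => ⟨(1 : L)⟩)
  obtain ⟨s, hs, h⟩ := exists_measurable_selection
    (fun x : L => Set.range fun u : U => (QuotientGroup.mk (x * u) : L ⧸ Γ)) u
    (fun x => (hemb x).isOpen_range.measurableSet) hum t htne ht
  refine ⟨s, hs, ?_, ?_⟩
  · have hK : IsCompact (⋃ x ∈ t, x • closure U) := t.isCompact_biUnion fun x _ => hcpt.smul x
    refine hK.closure_of_subset ?_
    rintro _ ⟨y, rfl⟩
    obtain ⟨x, hx, ⟨v, rfl⟩, hsx⟩ := h y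
    rw [hsx]
    refine Set.mem_iUnion₂.2 ⟨x, hx, ?_⟩
    have hv := congrFun (hu x) v
    simp only [Function.comp_apply] at hv
    rw [hv]
    exact Set.smul_mem_smul_set (subset_closure v.2)
  · intro y
    obtain ⟨x, hx, ⟨v, rfl⟩, hsx⟩ := h y
    rw [hsx]
    exact congrArg _ (congrFun (hu x) v)

end Lattice

/-! ### The cocycle of a bounded Borel section -/

section Cocycle

variable {L : Type*} [Group L] [TopologicalSpace L] [IsTopologicalGroup L]
  [T2Space L] [SecondCountableTopology L] [MeasurableSpace L] [BorelSpace L]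
  {Γ : Subgroup L} {s : L ⧸ Γ → L}

theorem IsQuotientSection.cocycle_mem (hs : IsQuotientSection Γ s) (g : L) (y : L ⧸ Γ) :
    (s y)⁻¹ * g * s (g⁻¹ • y) ∈ Γ := by
  rw [mul_assoc, ← QuotientGroup.eq, hs.mk_eq]
  have h : (QuotientGroup.mk (g * s (g⁻¹ • y)) : L ⧸ Γ) =
      g • (QuotientGroup.mk (s (g⁻¹ • y)) : L ⧸ Γ) := rfl
  rw [h, hs.mk_eq, smul_inv_smul]

theorem IsQuotientSection.cocycle_mem_compact (s : L ⧸ Γ → L) (g : L) (y : L ⧸ Γ) :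
    (s y)⁻¹ * g * s (g⁻¹ • y) ∈
      (closure (Set.range s))⁻¹ * {g} * closure (Set.range s) :=
  Set.mul_mem_mul (Set.mul_mem_mul (Set.inv_mem_inv.2 (subset_closure ⟨y, rfl⟩)) rfl)
    (subset_closure ⟨_, rfl⟩)

/-- The cocycle `(g, y) ↦ s(y)⁻¹ g s(g⁻¹y)` of a bounded Borel section `s`, as a simple function
of `y`. -/
noncomputable def IsQuotientSection.cocycle [DiscreteTopology Γ] [BorelSpace (L ⧸ Γ)]
    (hs : IsQuotientSection Γ s) (g : L) : SimpleFunc (L ⧸ Γ) Γ where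
  toFun y := ⟨(s y)⁻¹ * g * s (g⁻¹ • y), hs.cocycle_mem g y⟩
  measurableSet_fiber' γ := by
    have hm : Measurable fun y : L ⧸ Γ => (s y)⁻¹ * g * s (g⁻¹ • y) :=
      ((hs.measurable.inv).mul_const g).mul
        (hs.measurable.comp (continuous_const_smul g⁻¹).measurable)
    have h : (fun y : L ⧸ Γ => (⟨(s y)⁻¹ * g * s (g⁻¹ • y), hs.cocycle_mem g y⟩ : Γ)) ⁻¹' {γ} =
        (fun y : L ⧸ Γ => (s y)⁻¹ * g * s (g⁻¹ • y)) ⁻¹' {(γ : L)} := by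
      ext y
      simp [Subtype.ext_iff]
    rw [h]
    exact hm (measurableSet_singleton _)
  finite_range' := by
    have hK : IsCompact ((closure (Set.range s))⁻¹ * {g} * closure (Set.range s)) :=
      (hs.bounded.inv.mul isCompact_singleton).mul hs.bounded
    have hfin := (finite_inter_of_isCompact Γ hK).preimage
      (Subtype.val_injective (p := fun x => x ∈ Γ)).injOn
    refine hfin.subset ?_
    rintro _ ⟨y, rfl⟩
    exact ⟨hs.cocycle_mem g y, IsQuotientSection.cocycle_mem_compact s g y⟩

theorem IsQuotientSection.coe_cocycle [DiscreteTopology Γ] [BorelSpace (L ⧸ Γ)]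
    (hs : IsQuotientSection Γ s) (g : L) (y : L ⧸ Γ) :
    (hs.cocycle g y : L) = (s y)⁻¹ * g * s (g⁻¹ • y) := rfl

theorem IsQuotientSection.cocycle_mul [DiscreteTopology Γ] [BorelSpace (L ⧸ Γ)]
    (hs : IsQuotientSection Γ s) (g h : L) (y : L ⧸ Γ) :
    hs.cocycle (g * h) y = hs.cocycle g y * hs.cocycle h (g⁻¹ • y) := by
  refine Subtype.ext ?_
  rw [Subgroup.coe_mul, hs.coe_cocycle, hs.coe_cocycle, hs.coe_cocycle, smul_smul, mul_inv_rev]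
  group

end Cocycle

/-! ### Continuity of the induced action -/

section Continuity

variable {L : Type*} [Group L] [TopologicalSpace L] [IsTopologicalGroup L] [T2Space L]
  [LocallyCompactSpace L] [SecondCountableTopology L] [MeasurableSpace L] [BorelSpace L]
  {Γ : Subgroup L} [DiscreteTopology Γ] [CompactSpace (L ⧸ Γ)] [T2Space (L ⧸ Γ)]
  [BorelSpace (L ⧸ Γ)] {s : L ⧸ Γ → L} {m : Measure (L ⧸ Γ)}
  {E : Type*} [NormedAddCommGroup E] [NormedSpace ℝ E] {p : ℝ≥0∞} [Fact (1 ≤ p)]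

theorem IsInvariantProbability.measurePreserving {L X : Type*} [Group L] [MulAction L X]
    [MeasurableSpace X] [MeasurableConstSMul L X] {ν : Measure X}
    (hν : IsInvariantProbability L ν) (g : L) : MeasurePreserving (fun x : X => g • x) ν ν :=
  ⟨measurable_const_smul g, hν.map_smul g⟩

theorem IsInvariantProbability.smulInvariantMeasure {L X : Type*} [Group L] [MulAction L X]
    [MeasurableSpace X] [MeasurableConstSMul L X] {ν : Measure X}
    (hν : IsInvariantProbability L ν) : SMulInvariantMeasure L X ν :=
  ⟨fun g _ hA => (hν.measurePreserving g).measure_preimage hA.nullMeasurableSet⟩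

/-- Cover the closure of the image of `s` by finitely many open `O` so small that `x⁻¹gy` avoids `Γ
\ {1}` for `x, y ∈ O` and `g` near `1`. The cocycle can then be nontrivial at `y` only if `s(y)`
lies in some `O` that does not contain `s(g⁻¹y)`, and the measure of such `y` tends to `0` since
translation is continuous in measure. -/
theorem tendsto_measure_cocycle_ne_one (hm : IsInvariantProbability L m)
    (hs : IsQuotientSection Γ s) :
    Filter.Tendsto (fun g : L => m ((hs.cocycle g) ⁻¹' {1})ᶜ) (nhds 1) (nhds 0) := by
  have := hm.isProbability
  obtain ⟨N, hN, hNΓ⟩ : ∃ N : Set L, IsOpen N ∧ N ∩ Γ = {1} := by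
    have hd : IsDiscrete (Γ : Set L) := ⟨inferInstanceAs (DiscreteTopology Γ)⟩
    exact (isDiscrete_iff_forall_mem_exists_isOpen.1 hd) 1 Γ.one_mem
  have h1 : (1 : L) ∈ N := (hNΓ.ge rfl).1
  have hloc (a : L) : ∃ O : Set L, IsOpen O ∧ a ∈ O ∧
      ∀ᶠ g in nhds (1 : L), ∀ x ∈ O, ∀ y ∈ O, x⁻¹ * g * y ∈ N := by
    have hcont : Continuous fun q : L × L × L => q.2.1⁻¹ * q.1 * q.2.2 := by fun_prop
    have hpre : (fun q : L × L × L => q.2.1⁻¹ * q.1 * q.2.2) ⁻¹' N ∈ nhds ((1 : L), a, a) :=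
      (hN.preimage hcont).mem_nhds (by simpa using h1)
    rw [nhds_prod_eq, nhds_prod_eq] at hpre
    obtain ⟨V, hV, V', hV', hVV'⟩ := Filter.mem_prod_iff.1 hpre
    obtain ⟨O, hO, hOV⟩ := Filter.mem_prod_same_iff.1 hV'
    refine ⟨interior O, isOpen_interior, mem_interior_iff_mem_nhds.2 hO, ?_⟩
    filter_upwards [hV] with g hg x hx y hy
    exact hVV' (Set.mk_mem_prod hg
      (hOV (Set.mk_mem_prod (interior_subset hx) (interior_subset hy))))
  choose O hOo hOa hO using hloc
  obtain ⟨t, ht⟩ := hs.bounded.elim_finite_subcover O hOo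
    (fun a _ => Set.mem_iUnion.2 ⟨a, hOa a⟩)
  let act : C(L × (L ⧸ Γ), L ⧸ Γ) := ⟨fun q => q.1⁻¹ • q.2, by fun_prop⟩
  have hact : Filter.Tendsto act.curry (nhds 1) (nhds (act.curry 1)) :=
    act.curry.continuous.tendsto 1
  have hactmp (g : L) : MeasurePreserving (act.curry g) m m := hm.measurePreserving g⁻¹
  have hlim (a : L) : Filter.Tendsto (fun g : L =>
      m (symmDiff (act.curry g ⁻¹' (s ⁻¹' O a)) (act.curry 1 ⁻¹' (s ⁻¹' O a)))) (nhds 1) (nhds 0) :=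
    tendsto_measure_symmDiff_preimage_nhds_zero hact (Filter.Eventually.of_forall hactmp)
      (hactmp 1) (hs.measurable (hOo a).measurableSet).nullMeasurableSet (measure_ne_top m _)
  have hsum : Filter.Tendsto (fun g : L => ∑ a ∈ t,
      m (symmDiff (act.curry g ⁻¹' (s ⁻¹' O a)) (act.curry 1 ⁻¹' (s ⁻¹' O a)))) (nhds 1)
      (nhds 0) := by
    simpa using tendsto_finsetSum t fun a _ => hlim a
  refine tendsto_of_tendsto_of_tendsto_of_le_of_le' tendsto_const_nhds hsum
    (Filter.Eventually.of_forall fun _ => zero_le) ?_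
  filter_upwards [(Filter.eventually_all_finset t).2 fun a _ => hO a] with g hg
  refine (measure_mono ?_).trans (measure_biUnion_finset_le t _)
  intro y hy
  obtain ⟨a, ha, hya⟩ := Set.mem_iUnion₂.1 (ht (subset_closure ⟨y, rfl⟩))
  refine Set.mem_iUnion₂.2 ⟨a, ha, Or.inr ⟨by simpa [act] using hya, fun hya' => hy ?_⟩⟩
  have hmem : (hs.cocycle g y : L) ∈ N ∩ Γ := ⟨hg a ha _ hya _ hya', (hs.cocycle g y).2⟩
  rw [hNΓ] at hmem
  exact Subtype.ext hmem

/-- For `g` in a compact neighbourhood of `1` all cocycle values lie in one finite subset of `Γ`. -/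
theorem exists_bound_cocycle (hs : IsQuotientSection Γ s) (κ : Γ →* (E ≃ᵃⁱ[ℝ] E)) :
    ∃ C : ℝ, ∀ᶠ g in nhds (1 : L), ∀ y, ‖κ (hs.cocycle g y) 0‖ ≤ C := by
  obtain ⟨V, hV, hV1⟩ := exists_compact_mem_nhds (1 : L)
  have hK : IsCompact ((closure (Set.range s))⁻¹ * V * closure (Set.range s)) :=
    (hs.bounded.inv.mul hV).mul hs.bounded
  have hfin := (finite_inter_of_isCompact Γ hK).preimage
    (Subtype.val_injective (p := fun x => x ∈ Γ)).injOn
  refine ⟨∑ γ ∈ hfin.toFinset, ‖κ γ 0‖, ?_⟩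
  filter_upwards [hV1] with g hg y
  refine Finset.single_le_sum (f := fun γ => ‖κ γ 0‖) (fun _ _ => norm_nonneg _) ?_
  rw [Set.Finite.mem_toFinset]
  refine ⟨(hs.cocycle g y).2, ?_⟩
  exact Set.mul_subset_mul_right (Set.mul_subset_mul_left (Set.singleton_subset_iff.2 hg))
    (IsQuotientSection.cocycle_mem_compact s g y)

/-- The twist changes `f` only where the cocycle is nontrivial, by at most `2‖f‖ + C`. That set has
measure tending to `0`, so absolute continuity of the `L^p`-norm applies. -/
theorem tendsto_twist_cocycle [IsFiniteMeasure m] (hm : IsInvariantProbability L m)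
    (hs : IsQuotientSection Γ s)
    (κ : Γ →* (E ≃ᵃⁱ[ℝ] E)) (hp : p ≠ ∞) (f : Lp E p m) :
    Filter.Tendsto (fun g : L => edist (twist κ (hs.cocycle g) (MeasurePreserving.id m) f) f)
      (nhds 1) (nhds 0) := by
  obtain ⟨C, hC⟩ := exists_bound_cocycle hs κ
  have hb : MemLp (fun y => (‖f y‖ + C) + ‖f y‖) p m :=
    ((Lp.memLp f).norm.add (memLp_const C)).add (Lp.memLp f).norm
  rw [ENNReal.tendsto_nhds_zero]
  intro ε hε
  obtain ⟨r, hr, hrε⟩ : ∃ r : ℝ, 0 < r ∧ ENNReal.ofReal r ≤ ε := by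
    obtain ⟨r, hr0, hr⟩ := ENNReal.lt_iff_exists_nnreal_btwn.1 hε
    exact ⟨r, by exact_mod_cast hr0, by simpa using hr.le⟩
  obtain ⟨δ, hδ, h⟩ := hb.eLpNorm_indicator_le Fact.out hp hr
  filter_upwards [hC, ENNReal.tendsto_nhds_zero.1 (tendsto_measure_cocycle_ne_one hm hs)
    (ENNReal.ofReal δ) (ENNReal.ofReal_pos.2 hδ)] with g hg hgδ
  refine le_trans ?_ ((h _ ((hs.cocycle g).measurableSet_fiber 1).compl hgδ).trans hrε)
  rw [Lp.edist_def]
  refine eLpNorm_mono_ae ?_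
  filter_upwards [coeFn_twist κ (hs.cocycle g) (MeasurePreserving.id m) f] with y hy
  rw [Pi.sub_apply, hy]
  by_cases h1 : hs.cocycle g y = 1
  · have hz : κ (hs.cocycle g y) (f (id y)) = f y := by
      rw [h1, map_one]
      rfl
    rw [hz, sub_self, norm_zero]
    exact norm_nonneg _
  · rw [Set.indicator_of_mem (by simpa using h1)]
    refine le_trans ?_ (Real.le_norm_self _)
    refine (norm_sub_le _ _).trans ?_
    gcongr
    exact (norm_affine_apply_le _ _).trans (by gcongr; exacts [le_rfl, hg y])

/-- The action of `L` on `L^p(L/Γ; E)` induced from the affine isometric action `κ` of `Γ` on `E`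
by means of the section `s`. -/
noncomputable def inducedAction [IsFiniteMeasure m] (p : ℝ≥0∞) [Fact (1 ≤ p)]
    (hm : IsInvariantProbability L m) (hs : IsQuotientSection Γ s) (κ : Γ →* (E ≃ᵃⁱ[ℝ] E)) :
    L →* (Lp E p m ≃ᵃⁱ[ℝ] Lp E p m) :=
  cocycleAction κ hs.cocycle hm.measurePreserving hs.cocycle_mul

theorem inducedAction_apply [IsFiniteMeasure m] (hm : IsInvariantProbability L m)
    (hs : IsQuotientSection Γ s) (κ : Γ →* (E ≃ᵃⁱ[ℝ] E)) (g : L) (f : Lp E p m) :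
    inducedAction p hm hs κ g f = twist κ (hs.cocycle g) (hm.measurePreserving g⁻¹) f := rfl

theorem isInduced_inducedAction [IsFiniteMeasure m] (hm : IsInvariantProbability L m)
    (hs : IsQuotientSection Γ s) (κ : Γ →* (E ≃ᵃⁱ[ℝ] E)) :
    IsInduced m s κ (inducedAction p hm hs κ) := by
  intro g f
  filter_upwards [coeFn_twist κ (hs.cocycle g) (hm.measurePreserving g⁻¹) f] with y hy
  exact ⟨hs.cocycle g y, rfl, hy⟩

theorem continuous_inducedAction [IsFiniteMeasure m] (hm : IsInvariantProbability L m)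
    (hs : IsQuotientSection Γ s) (κ : Γ →* (E ≃ᵃⁱ[ℝ] E)) (hp : p ≠ ∞) (f : Lp E p m) :
    Continuous fun g : L => inducedAction p hm hs κ g f := by
  have := hm.smulInvariantMeasure
  have : Fact (p ≠ ∞) := ⟨hp⟩
  have hone : Filter.Tendsto (fun g : L => edist (inducedAction p hm hs κ g f) f)
      (nhds 1) (nhds 0) := by
    have htrans : Filter.Tendsto (fun g : L => edist (DomMulAct.mk g⁻¹ • f) f) (nhds 1)
        (nhds 0) := by
      have hc : Continuous fun g : L => edist (DomMulAct.mk g⁻¹ • f) f :=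
        ((DomMulAct.continuous_mk.comp continuous_inv).smul continuous_const).edist
          continuous_const
      simpa using hc.tendsto 1
    have hsum := htrans.add (tendsto_twist_cocycle hm hs κ hp f)
    rw [add_zero] at hsum
    refine tendsto_of_tendsto_of_tendsto_of_le_of_le tendsto_const_nhds hsum
      (fun _ => zero_le) fun g => ?_
    -- The action is translation followed by a twist over the identity map. The twist is isometric,
    -- so the two displacements add.
    have hfac : inducedAction p hm hs κ g f =
        twist κ (hs.cocycle g) (MeasurePreserving.id m) (DomMulAct.mk g⁻¹ • f) := by
      refine Lp.ext ?_
      filter_upwards [coeFn_twist κ (hs.cocycle g) (hm.measurePreserving g⁻¹) f,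
        coeFn_twist κ (hs.cocycle g) (MeasurePreserving.id m) (DomMulAct.mk g⁻¹ • f),
        DomMulAct.smul_Lp_ae_eq (DomMulAct.mk g⁻¹) f] with y h₁ h₂ h₃
      rw [inducedAction_apply, h₁, h₂, id, h₃]
      rfl
    rw [hfac]
    refine (edist_triangle _ (twist κ (hs.cocycle g) (MeasurePreserving.id m) f) _).trans ?_
    rw [(isometry_twist κ (hs.cocycle g) (MeasurePreserving.id m)).edist_eq]
  refine continuous_iff_continuousAt.2 fun g₀ => ?_
  rw [ContinuousAt, tendsto_iff_edist_tendsto_0]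
  have hshift : Filter.Tendsto (fun g : L => g₀⁻¹ * g) (nhds g₀) (nhds 1) := by
    have hc : Continuous fun g : L => g₀⁻¹ * g := by fun_prop
    simpa using hc.tendsto g₀
  -- Continuity at `g₀` reduces to continuity at `1` because `g₀` acts isometrically.
  refine (hone.comp hshift).congr fun g => ?_
  rw [Function.comp_apply, ← (inducedAction p hm hs κ g₀).isometry.edist_eq]
  congr 1
  change (inducedAction p hm hs κ g₀ * inducedAction p hm hs κ (g₀⁻¹ * g)) f = _
  rw [← map_mul, mul_inv_cancel_left]

theorem isAffineLpAction_of_continuous {L : Type*} [Group L] [TopologicalSpace L]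
    (hE : IsLpSpace p E) (ρ : L →* (E ≃ᵃⁱ[ℝ] E)) (hρ : ∀ v, Continuous fun g => ρ g v) :
    IsAffineLpAction p ρ where
  isLpSpace := hE
  continuous_linear v := by
    have h (g : L) : (ρ g).linearIsometryEquiv v = ρ g v - ρ g 0 := by
      have := (ρ g).map_vadd 0 v
      simp only [vadd_eq_add, add_zero] at this
      rw [this, add_sub_cancel_right]
    simp only [h]
    exact (hρ v).sub (hρ 0)
  continuous_cocycle := hρ 0

end Continuity

/-! ### Lifting measures from the quotient by a lattice -/

section Lift

variable {L : Type*} [Group L] [TopologicalSpace L] [IsTopologicalGroup L] [T2Space L]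
  [LocallyCompactSpace L] [SecondCountableTopology L] [MeasurableSpace L] [BorelSpace L]
  {Γ : Subgroup L} [DiscreteTopology Γ] [CompactSpace (L ⧸ Γ)]
  [BorelSpace (L ⧸ Γ)] {s : L ⧸ Γ → L} {m m' : Measure (L ⧸ Γ)}

/-- The right `Γ`-invariant measure on `L` obtained from a measure on `L/Γ` and a section `s`. -/
noncomputable def lift (s : L ⧸ Γ → L) (m : Measure (L ⧸ Γ)) : Measure L :=
  Measure.sum fun γ : Γ => m.map fun y => s y * γ

theorem lift_apply (hs : IsQuotientSection Γ s) {A : Set L} (hA : MeasurableSet A) :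
    lift s m A = ∑' γ : Γ, m {y | s y * γ ∈ A} := by
  rw [lift, Measure.sum_apply _ hA]
  exact tsum_congr fun γ => Measure.map_apply (hs.measurable.mul_const _) hA

theorem lintegral_lift (hs : IsQuotientSection Γ s) {f : L → ℝ≥0∞} (hf : Measurable f) :
    ∫⁻ x, f x ∂(lift s m) = ∫⁻ y, ∑' γ : Γ, f (s y * γ) ∂m := by
  have := countable_of_discrete Γ
  rw [lift, lintegral_sum_measure, lintegral_tsum]
  · exact tsum_congr fun γ => lintegral_map hf (hs.measurable.mul_const _)
  · exact fun γ => (hf.comp (hs.measurable.mul_const _)).aemeasurable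

theorem tsum_coset_eq {x x' : L} (f : L → ℝ≥0∞)
    (h : (QuotientGroup.mk x : L ⧸ Γ) = QuotientGroup.mk x') :
    ∑' γ : Γ, f (x * γ) = ∑' γ : Γ, f (x' * γ) := by
  rw [← (Equiv.mulLeft (⟨x⁻¹ * x', QuotientGroup.eq.1 h⟩ : Γ)).tsum_eq (fun γ : Γ => f (x * γ))]
  refine tsum_congr fun γ => ?_
  simp [mul_assoc]

/-- The sum over a coset does not depend on the representative, so `g s(y)` may replace `s(gy)`. -/
theorem lift_map_smul (hs : IsQuotientSection Γ s) (g : L) :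
    lift s (m.map fun y => g • y) = (lift s m).map fun x => g * x := by
  refine Measure.ext_of_lintegral _ fun f hf => ?_
  have hsum : Measurable fun y : L ⧸ Γ => ∑' γ : Γ, f (s y * γ) := by
    have := countable_of_discrete Γ
    exact Measurable.tsum fun γ => hf.comp (hs.measurable.mul_const _)
  rw [lintegral_lift hs hf, lintegral_map hsum (measurable_const_smul g),
    lintegral_map hf (measurable_const_mul g),
    lintegral_lift (f := fun x => f (g * x)) hs (hf.comp (measurable_const_mul g))]
  refine lintegral_congr fun y => ?_
  rw [tsum_coset_eq f (x' := g * s y)]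
  · simp only [mul_assoc]
  · rw [hs.mk_eq]
    exact congrArg (g • ·) (hs.mk_eq y).symm

theorem lift_map_mul_right (hs : IsQuotientSection Γ s) (γ : Γ) :
    (lift s m).map (fun x : L => x * (γ : L)) = lift s m := by
  refine Measure.ext_of_lintegral _ fun f hf => ?_
  rw [lintegral_map hf (measurable_mul_const _), lintegral_lift hs hf,
    lintegral_lift (f := fun x => f (x * γ)) hs (hf.comp (measurable_mul_const _))]
  refine lintegral_congr fun y => ?_
  rw [← (Equiv.mulRight γ).tsum_eq (fun δ : Γ => f (s y * δ))]
  exact tsum_congr fun δ => by simp [mul_assoc]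

theorem isFiniteMeasureOnCompacts_lift [IsFiniteMeasure m] (hs : IsQuotientSection Γ s) :
    IsFiniteMeasureOnCompacts (lift s m) := by
  refine ⟨fun K hK => ?_⟩
  have hK' : IsCompact ((closure (Set.range s))⁻¹ * K) := hs.bounded.inv.mul hK
  have hfin := (finite_inter_of_isCompact Γ hK').preimage
    (Subtype.val_injective (p := fun x => x ∈ Γ)).injOn
  rw [lift_apply hs hK.measurableSet, tsum_eq_sum (s := hfin.toFinset)]
  · exact ENNReal.sum_lt_top.2 fun γ _ => measure_lt_top m _
  · intro γ hγ
    rw [Set.Finite.mem_toFinset] at hγ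
    have hempty : {y | s y * γ ∈ K} = ∅ := by
      refine Set.eq_empty_of_forall_notMem fun y hy => hγ ⟨γ.2, ?_⟩
      have hmul := Set.mul_mem_mul
        (Set.inv_mem_inv.2 (subset_closure (Set.mem_range_self (f := s) y))) hy
      rwa [inv_mul_cancel_left] at hmul
    rw [hempty, measure_empty]

theorem IsQuotientSection.mk_mul_coe (hs : IsQuotientSection Γ s) (y : L ⧸ Γ) (γ : Γ) :
    (QuotientGroup.mk (s y * γ) : L ⧸ Γ) = y := by
  rw [QuotientGroup.mk_mul_of_mem _ γ.2, hs.mk_eq]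

theorem IsQuotientSection.measurableSet_domain (hs : IsQuotientSection Γ s) :
    MeasurableSet {x : L | s (QuotientGroup.mk x) = x} :=
  measurableSet_eq_fun (hs.measurable.comp QuotientGroup.continuous_mk.measurable) measurable_id

theorem IsQuotientSection.domain_subset (s : L ⧸ Γ → L) :
    {x : L | s (QuotientGroup.mk x) = x} ⊆ closure (Set.range s) :=
  fun _ hx => subset_closure ⟨_, hx⟩

/-- On the fundamental domain cut out by `s` only the term `γ = 1` of the lift survives; hence the
lift determines the measure. -/
theorem apply_eq_lift (hs : IsQuotientSection Γ s) {A : Set (L ⧸ Γ)} (hA : MeasurableSet A) :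
    m A = lift s m (QuotientGroup.mk ⁻¹' A ∩ {x | s (QuotientGroup.mk x) = x}) := by
  rw [lift_apply hs ((QuotientGroup.continuous_mk.measurable hA).inter hs.measurableSet_domain),
    tsum_eq_single (1 : Γ)]
  · congr 1
    ext y
    simp [hs.mk_eq]
  · intro γ hγ
    have hempty : {y | s y * γ ∈ QuotientGroup.mk ⁻¹' A ∩ {x | s (QuotientGroup.mk x) = x}} =
        ∅ := by
      refine Set.eq_empty_of_forall_notMem fun y hy => hγ ?_
      have h : s (QuotientGroup.mk (s y * γ)) = s y * γ := hy.2
      rw [hs.mk_mul_coe] at h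
      exact Subtype.ext (left_eq_mul.1 h)
    rw [hempty, measure_empty]

/-- The `γ`-translates of the fundamental domain partition `L`, and invariance identifies the mass
on each with that on the domain itself. -/
theorem lift_map_restrict (hs : IsQuotientSection Γ s) (μ : Measure L)
    (hμ : ∀ γ : Γ, μ.map (fun x : L => x * (γ : L)) = μ) :
    lift s ((μ.restrict {x | s (QuotientGroup.mk x) = x}).map QuotientGroup.mk) = μ := by
  have := countable_of_discrete Γ
  ext A hA
  have hmk : Measurable (QuotientGroup.mk : L → L ⧸ Γ) := QuotientGroup.continuous_mk.measurable
  have hpiece (γ : Γ) : MeasurableSet {x : L | s (QuotientGroup.mk x) * γ = x} :=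
    measurableSet_eq_fun ((hs.measurable.comp hmk).mul_const _) measurable_id
  have hunion : A = ⋃ γ : Γ, {x : L | s (QuotientGroup.mk x) * γ = x} ∩ A := by
    rw [← Set.iUnion_inter]
    refine (Set.inter_eq_right.2 fun x _ => Set.mem_iUnion.2 ?_).symm
    refine ⟨⟨(s (QuotientGroup.mk x))⁻¹ * x, QuotientGroup.eq.1 (hs.mk_eq _)⟩, ?_⟩
    simp
  have hdisj : Pairwise (Function.onFun Disjoint
      fun γ : Γ => {x : L | s (QuotientGroup.mk x) * γ = x} ∩ A) := by
    intro γ δ hγδ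
    refine Set.disjoint_left.2 fun x hx hx' => hγδ (Subtype.ext ?_)
    exact mul_left_cancel (hx.1.trans hx'.1.symm)
  conv_rhs => rw [hunion, measure_iUnion hdisj fun γ => (hpiece γ).inter hA]
  rw [lift_apply hs hA]
  refine tsum_congr fun γ => ?_
  have hset : MeasurableSet {y : L ⧸ Γ | s y * γ ∈ A} := (hs.measurable.mul_const _) hA
  rw [Measure.map_apply hmk hset, Measure.restrict_apply (hmk hset)]
  conv_rhs => rw [← hμ γ, Measure.map_apply (measurable_mul_const _) ((hpiece γ).inter hA)]
  congr 1
  ext x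
  simp only [Set.mem_inter_iff, Set.mem_preimage, Set.mem_ofPred_eq,
    QuotientGroup.mk_mul_of_mem _ γ.2, mul_left_inj]
  constructor
  · rintro ⟨h₁, h₂⟩
    rw [h₂] at h₁
    exact ⟨h₂, h₁⟩
  · rintro ⟨h₁, h₂⟩
    exact ⟨by rwa [h₁], h₁⟩

theorem eq_smul_of_lift_eq_smul (hs : IsQuotientSection Γ s) {c : ℝ≥0∞}
    (h : lift s m = c • lift s m') : m = c • m' := by
  ext A hA
  rw [apply_eq_lift hs hA, h, Measure.smul_apply, Measure.smul_apply, ← apply_eq_lift hs hA]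

theorem eq_smul_inv_of_isMulRightInvariant (η μ : Measure L) [μ.IsHaarMeasure]
    [η.IsMulRightInvariant] [IsFiniteMeasureOnCompacts η] : ∃ c : ℝ≥0∞, η = c • μ.inv := by
  refine ⟨(Measure.haarScalarFactor η.inv μ : ℝ≥0∞), ?_⟩
  have h := Measure.isMulLeftInvariant_eq_smul η.inv μ
  calc η = η.inv.inv := (Measure.inv_inv η).symm
    _ = (Measure.haarScalarFactor η.inv μ • μ).inv := congrArg Measure.inv h
    _ = _ := Measure.map_smul ..

/-- Push the right Haar measure on a bounded fundamental domain to a finite measure `m` on the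
quotient. A left translate of right Haar measure is a multiple of it, and the multiple is `1`
because translation preserves the finite total mass of `m`. Thus `m` is invariant, and right Haar
measure is also left invariant: a group with a uniform lattice is unimodular. -/
theorem exists_isInvariantProbability_and_haar (Γ : Subgroup L) [DiscreteTopology Γ]
    [CompactSpace (L ⧸ Γ)] [BorelSpace (L ⧸ Γ)] (μ : Measure L) [μ.IsHaarMeasure] :
    (∃ m : Measure (L ⧸ Γ), IsInvariantProbability L m) ∧ μ.IsMulRightInvariant := by
  obtain ⟨s, hs⟩ := exists_isQuotientSection Γ
  have hne : μ.inv ≠ 0 := fun h => NeZero.ne μ (by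
    rw [← Measure.inv_inv μ, h]
    simp [Measure.inv_def])
  set m : Measure (L ⧸ Γ) := (μ.inv.restrict {x | s (QuotientGroup.mk x) = x}).map QuotientGroup.mk
    with hm
  have hlift : lift s m = μ.inv :=
    lift_map_restrict hs μ.inv fun γ => map_mul_right_eq_self μ.inv (γ : L)
  have huniv : m Set.univ = μ.inv {x | s (QuotientGroup.mk x) = x} := by
    rw [hm, Measure.map_apply QuotientGroup.continuous_mk.measurable .univ]
    simp
  have hfin : m Set.univ ≠ ∞ := by
    rw [huniv]
    exact ((measure_mono (IsQuotientSection.domain_subset s)).trans_lt hs.bounded.measure_lt_top).ne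
  have hpos : m Set.univ ≠ 0 := by
    intro h
    rw [Measure.measure_univ_eq_zero] at h
    refine hne ?_
    rw [← hlift, h]
    simp [lift]
  have hinv (g : L) : m.map (fun y => g • y) = m := by
    have hR : (μ.inv.map fun x => g * x).IsMulRightInvariant := by
      refine ⟨fun a => ?_⟩
      rw [Measure.map_map (measurable_mul_const a) (measurable_const_mul g)]
      conv_rhs => rw [← map_mul_right_eq_self μ.inv a,
        Measure.map_map (measurable_const_mul g) (measurable_mul_const a)]
      congr 1
      funext x
      simp [mul_assoc]
    have hF : IsFiniteMeasureOnCompacts (μ.inv.map fun x => g * x) :=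
      Measure.IsFiniteMeasureOnCompacts.map μ.inv (Homeomorph.mulLeft g)
    obtain ⟨c, hc⟩ := eq_smul_inv_of_isMulRightInvariant (μ.inv.map fun x => g * x) μ
    rw [← hlift, ← lift_map_smul hs] at hc
    have h := eq_smul_of_lift_eq_smul hs hc
    have hc1 : c = 1 := by
      have hu := congrArg (fun κ => κ Set.univ) h
      simp only [Measure.smul_apply, smul_eq_mul] at hu
      rw [Measure.map_apply (measurable_const_smul g) .univ, Set.preimage_univ] at hu
      exact ((ENNReal.mul_eq_right hpos hfin).1 hu.symm)
    rw [h, hc1, one_smul]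
  refine ⟨⟨(m Set.univ)⁻¹ • m, ⟨⟨?_⟩, fun g => ?_⟩⟩, ?_⟩
  · rw [Measure.smul_apply, smul_eq_mul, ENNReal.inv_mul_cancel hpos hfin]
  · rw [Measure.map_smul, hinv]
  · have hL : μ.inv.IsMulLeftInvariant :=
      ⟨fun g => by rw [← hlift, ← lift_map_smul hs, hinv]⟩
    have hc := Measure.isMulLeftInvariant_eq_smul μ.inv μ
    set c := Measure.haarScalarFactor μ.inv μ with hcdef
    have hc0 : c ≠ 0 := fun h => hne (by rw [hc, h, zero_smul])
    have hμ : μ = c⁻¹ • μ.inv := by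
      rw [hc, smul_smul, inv_mul_cancel₀ hc0, one_smul]
    refine ⟨fun g => ?_⟩
    conv_lhs => rw [hμ]
    rw [Measure.map_smul, map_mul_right_eq_self, ← hμ]

theorem eq_smul_of_isMulRightInvariant (η μ : Measure L) [μ.IsHaarMeasure]
    [μ.IsMulRightInvariant] [η.IsMulRightInvariant] [IsFiniteMeasureOnCompacts η] :
    ∃ c : ℝ≥0∞, η = c • μ := by
  obtain ⟨c, hc⟩ := eq_smul_inv_of_isMulRightInvariant η μ
  obtain ⟨d, hd⟩ := eq_smul_inv_of_isMulRightInvariant μ μ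
  have hμ : μ.inv = d • μ := by
    conv_lhs => rw [hd]
    rw [Measure.inv_def, Measure.map_smul, ← Measure.inv_def, Measure.inv_inv]
  exact ⟨c * d, by rw [hc, hμ, smul_smul]⟩

/-- A measure on a group that is invariant under right translation by a dense set is invariant. -/
theorem isMulRightInvariant_of_dense (η : Measure L) [IsFiniteMeasureOnCompacts η] {S : Set L}
    (hS : Dense S) (h : ∀ g ∈ S, η.map (fun x => x * g) = η) : η.IsMulRightInvariant := by
  refine ⟨fun g => ?_⟩
  have hfc : IsFiniteMeasureOnCompacts (η.map fun x => x * g) :=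
    Measure.IsFiniteMeasureOnCompacts.map η (Homeomorph.mulRight g)
  refine Measure.ext_of_integral_eq_on_compactlySupported fun f => ?_
  have hint (g : L) : ∫ x, f x ∂(η.map fun x => x * g) = ∫ y, f (y⁻¹ * g) ∂η.inv := by
    calc ∫ x, f x ∂(η.map fun x => x * g) = ∫ x, f (x * g) ∂η :=
          integral_map (measurable_mul_const g).aemeasurable
            f.continuous.stronglyMeasurable.aestronglyMeasurable
      _ = ∫ y, f (y⁻¹ * g) ∂η.inv := by
          rw [Measure.inv_def]
          refine Eq.trans ?_ (integral_map_equiv (MeasurableEquiv.inv L) _).symm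
          simp
  have hcont : Continuous fun g : L => ∫ x, f x ∂(η.map fun x => x * g) := by
    simp only [hint]
    exact continuous_integral_apply_inv_mul f.continuous f.hasCompactSupport
  have heq : (fun g : L => ∫ x, f x ∂(η.map fun x => x * g)) = fun _ => ∫ x, f x ∂η :=
    hcont.ext_on hS continuous_const fun g hg => by
      change ∫ x, f x ∂(η.map fun x => x * g) = ∫ x, f x ∂η
      rw [h g hg]
  exact congrFun heq g

end Lift

/-! ### Unique ergodicity of the action of `G` on `(G × H)/Γ` -/

section UniqueErgodicity

variable {G H : Type*}
  [Group G] [TopologicalSpace G] [IsTopologicalGroup G] [LocallyCompactSpace G]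
  [SecondCountableTopology G] [T2Space G] [MeasurableSpace G] [BorelSpace G]
  [Group H] [TopologicalSpace H] [IsTopologicalGroup H] [LocallyCompactSpace H]
  [SecondCountableTopology H] [T2Space H] [MeasurableSpace H] [BorelSpace H]

theorem exists_isCompact_measure_pos (μ : Measure G) [μ.IsHaarMeasure] :
    ∃ K : Set G, IsCompact K ∧ μ K ≠ 0 ∧ μ K ≠ ∞ := by
  obtain ⟨K, hK, hK1⟩ := exists_compact_mem_nhds (1 : G)
  exact ⟨K, hK, (Measure.measure_pos_of_mem_nhds μ hK1).ne', hK.measure_lt_top.ne⟩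

theorem isMulRightInvariant_fst_of_prod (μ : Measure G) (ν : Measure H) [μ.IsHaarMeasure]
    [ν.IsHaarMeasure] [(μ.prod ν).IsMulRightInvariant] : μ.IsMulRightInvariant := by
  obtain ⟨K, hK, hK0, hKt⟩ := exists_isCompact_measure_pos ν
  refine ⟨fun g => ?_⟩
  ext A hA
  have h := congrArg (fun κ => κ (A ×ˢ K)) (map_mul_right_eq_self (μ.prod ν) (g, (1 : H)))
  have hpre : (fun x : G × H => x * (g, 1)) ⁻¹' (A ×ˢ K) = ((fun x => x * g) ⁻¹' A) ×ˢ K := by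
    ext x
    simp
  rw [Measure.map_apply (measurable_mul_const _) (hA.prod hK.measurableSet), hpre,
    Measure.prod_prod, Measure.prod_prod] at h
  rw [Measure.map_apply (measurable_mul_const _) hA]
  exact (ENNReal.mul_left_inj hK0 hKt).1 h

theorem isMulRightInvariant_snd_of_prod (μ : Measure G) (ν : Measure H) [μ.IsHaarMeasure]
    [ν.IsHaarMeasure] [(μ.prod ν).IsMulRightInvariant] : ν.IsMulRightInvariant := by
  obtain ⟨K, hK, hK0, hKt⟩ := exists_isCompact_measure_pos μ
  refine ⟨fun g => ?_⟩
  ext A hA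
  have h := congrArg (fun κ => κ (K ×ˢ A)) (map_mul_right_eq_self (μ.prod ν) ((1 : G), g))
  have hpre : (fun x : G × H => x * (1, g)) ⁻¹' (K ×ˢ A) = K ×ˢ ((fun x => x * g) ⁻¹' A) := by
    ext x
    simp
  rw [Measure.map_apply (measurable_mul_const _) (hK.measurableSet.prod hA), hpre,
    Measure.prod_prod, Measure.prod_prod] at h
  rw [Measure.map_apply (measurable_mul_const _) hA]
  exact (ENNReal.mul_right_inj hK0 hKt).1 h

/-- A measure on `G × H` that is invariant under left translation by `G` is the product of a Haar
measure of `G` and a measure on `H`. -/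
theorem exists_eq_prod_of_map_mul_left (μ : Measure G) [μ.IsHaarMeasure] (τ : Measure (G × H))
    [IsFiniteMeasureOnCompacts τ] (hτ : ∀ g : G, τ.map (fun x => (g, 1) * x) = τ) :
    ∃ η : Measure H, IsFiniteMeasureOnCompacts η ∧ τ = μ.prod η := by
  -- If `τ = μ ⊗ η` then `η B = τ(K₀ × B) / μ K₀`, so this quotient defines `η`. For relatively
  -- compact `B`, the measure `A ↦ τ(A × B)` is left invariant, hence a multiple of `μ`; general `B`
  -- are exhausted by compact sets.
  obtain ⟨K₀, hK₀, h0, htop⟩ := exists_isCompact_measure_pos μ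
  set η : Measure H := (μ K₀)⁻¹ • (τ.restrict (K₀ ×ˢ Set.univ)).map Prod.snd with hη
  have hηapply {B : Set H} (hB : MeasurableSet B) : η B = (μ K₀)⁻¹ * τ (K₀ ×ˢ B) := by
    rw [hη, Measure.smul_apply, Measure.map_apply measurable_snd hB,
      Measure.restrict_apply (measurable_snd hB), smul_eq_mul]
    congr 2
    ext x
    simp [and_comm]
  have hηfin : IsFiniteMeasureOnCompacts η := by
    refine ⟨fun K hK => ?_⟩
    rw [hηapply hK.measurableSet]
    exact ENNReal.mul_lt_top (ENNReal.inv_lt_top.2 (pos_iff_ne_zero.2 h0))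
      (hK₀.prod hK).measure_lt_top
  have hcpt {A : Set G} {B K : Set H} (hA : MeasurableSet A) (hB : MeasurableSet B)
      (hK : IsCompact K) (hBK : B ⊆ K) : τ (A ×ˢ B) = μ A * η B := by
    set κ : Measure G := (τ.restrict (Set.univ ×ˢ B)).map Prod.fst with hκ
    have hκapply {A : Set G} (hA : MeasurableSet A) : κ A = τ (A ×ˢ B) := by
      rw [hκ, Measure.map_apply measurable_fst hA, Measure.restrict_apply (measurable_fst hA)]
      congr 1
      ext x
      simp
    have hκfin : IsFiniteMeasureOnCompacts κ := by
      refine ⟨fun C hC => ?_⟩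
      rw [hκapply hC.measurableSet]
      exact (measure_mono (Set.prod_mono_right hBK)).trans_lt (hC.prod hK).measure_lt_top
    have hκinv : κ.IsMulLeftInvariant := by
      refine ⟨fun g => ?_⟩
      ext A hA
      rw [Measure.map_apply (measurable_const_mul g) hA, hκapply hA,
        hκapply (measurable_const_mul g hA)]
      conv_rhs => rw [← hτ g, Measure.map_apply (measurable_const_mul _) (hA.prod hB)]
      congr 1
      ext x
      simp
    have hc := Measure.isMulLeftInvariant_eq_smul κ μ
    set c : ℝ≥0∞ := (Measure.haarScalarFactor κ μ : ℝ≥0∞) with hcdef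
    have hκc {A : Set G} (hA : MeasurableSet A) : τ (A ×ˢ B) = c * μ A := by
      rw [← hκapply hA, hc]
      rfl
    rw [hηapply hB, hκc hA, hκc hK₀.measurableSet, mul_comm c (μ K₀), ← mul_assoc (μ K₀)⁻¹,
      ENNReal.inv_mul_cancel h0 htop, one_mul, mul_comm]
  refine ⟨η, hηfin, (Measure.prod_eq fun A B hA hB => ?_).symm⟩
  set C := compactCovering H with hC
  have hBC : B = ⋃ n, B ∩ C n := by
    rw [← Set.inter_iUnion, iUnion_compactCovering, Set.inter_univ]
  have hmono : Monotone fun n => B ∩ C n := fun i j hij =>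
    Set.inter_subset_inter_right _ (compactCovering_subset H hij)
  have hCm (n : ℕ) : MeasurableSet (C n) := (isCompact_compactCovering H n).measurableSet
  have hl : τ (A ×ˢ B) = ⨆ n, τ (A ×ˢ (B ∩ C n)) := by
    conv_lhs => rw [hBC, Set.prod_iUnion]
    exact Monotone.measure_iUnion fun i j hij => Set.prod_mono_right (hmono hij)
  have hr : η B = ⨆ n, η (B ∩ C n) := by
    conv_lhs => rw [hBC]
    exact hmono.measure_iUnion
  rw [hl, hr, ENNReal.mul_iSup]
  exact iSup_congr fun n => hcpt hA (hB.inter (hCm n)) (isCompact_compactCovering H n)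
    Set.inter_subset_right

variable {Γ : Subgroup (G × H)} [DiscreteTopology Γ] [CompactSpace ((G × H) ⧸ Γ)]
  [BorelSpace ((G × H) ⧸ Γ)] {s : (G × H) ⧸ Γ → G × H} {m m' : Measure ((G × H) ⧸ Γ)}

/-- The lift splits as `μ ⊗ η` by left `G`-invariance. `G` is unimodular, so right translation by
`γ` leaves the factor `μ` alone, and `η` is invariant under the dense projection of `Γ`, hence under
`H`. -/
theorem lift_eq_smul_haar (hd : Dense (Prod.snd '' (Γ : Set (G × H))))
    (hs : IsQuotientSection Γ s) [IsFiniteMeasure m]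
    (hm : ∀ g : G, m.map (fun y => ((g, 1) : G × H) • y) = m) (μ : Measure G) (ν : Measure H)
    [μ.IsHaarMeasure] [ν.IsHaarMeasure] :
    ∃ c : ℝ≥0∞, lift s m = c • μ.prod ν := by
  have := isFiniteMeasureOnCompacts_lift (m := m) hs
  have := (exists_isInvariantProbability_and_haar Γ (μ.prod ν)).2
  have := isMulRightInvariant_fst_of_prod μ ν
  have := isMulRightInvariant_snd_of_prod μ ν
  obtain ⟨η, _, hη⟩ := exists_eq_prod_of_map_mul_left μ (lift s m)
    fun g => by rw [← lift_map_smul hs, hm]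
  obtain ⟨K, hK, hK0, hKt⟩ := exists_isCompact_measure_pos μ
  have hηinv : η.IsMulRightInvariant := by
    refine isMulRightInvariant_of_dense η hd ?_
    rintro _ ⟨γ, hγ, rfl⟩
    ext B hB
    have h := congrArg (fun κ => κ (K ×ˢ B)) (lift_map_mul_right (m := m) hs ⟨γ, hγ⟩)
    have hpre : (fun x : G × H => x * γ) ⁻¹' (K ×ˢ B) =
        ((fun x => x * γ.1) ⁻¹' K) ×ˢ ((fun x => x * γ.2) ⁻¹' B) := by
      ext x
      simp
    simp only at h
    rw [Measure.map_apply (measurable_mul_const _) (hK.measurableSet.prod hB), hpre, hη,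
      Measure.prod_prod, Measure.prod_prod, measure_preimage_mul_right] at h
    rw [Measure.map_apply (measurable_mul_const _) hB]
    exact (ENNReal.mul_right_inj hK0 hKt).1 h
  obtain ⟨c, hc⟩ := eq_smul_of_isMulRightInvariant η ν
  exact ⟨c, by rw [hη, hc, Measure.prod_smul_right]⟩

/-- Both lifts are multiples of Haar measure, and total mass `1` on the same fundamental domain
fixes the constant. -/
theorem eq_of_invariant (hd : Dense (Prod.snd '' (Γ : Set (G × H))))
    [IsProbabilityMeasure m] [IsProbabilityMeasure m']
    (hm : ∀ g : G, m.map (fun y => ((g, 1) : G × H) • y) = m)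
    (hm' : ∀ g : G, m'.map (fun y => ((g, 1) : G × H) • y) = m') : m = m' := by
  obtain ⟨s, hs⟩ := exists_isQuotientSection Γ
  obtain ⟨c, hc⟩ := lift_eq_smul_haar hd hs hm Measure.haar Measure.haar
  obtain ⟨d, hd'⟩ := lift_eq_smul_haar hd hs hm' Measure.haar Measure.haar
  have h1 := apply_eq_lift (m := m) hs .univ
  have h2 := apply_eq_lift (m := m') hs .univ
  rw [hc, measure_univ, Measure.smul_apply, smul_eq_mul] at h1
  rw [hd', measure_univ, Measure.smul_apply, smul_eq_mul] at h2
  have hcd : c = d := by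
    rw [ENNReal.eq_inv_of_mul_eq_one_left h1.symm, ENNReal.eq_inv_of_mul_eq_one_left h2.symm]
  have h : lift s m = (1 : ℝ≥0∞) • lift s m' := by rw [hc, hd', hcd, one_smul]
  rw [eq_smul_of_lift_eq_smul hs h, one_smul]

/-- The set of cosets that meet `G × N` is a null set if `N` is. -/
theorem measure_meets_null (hd : Dense (Prod.snd '' (Γ : Set (G × H)))) [IsFiniteMeasure m]
    (hm : ∀ g : G, m.map (fun y => ((g, 1) : G × H) • y) = m) (ν : Measure H) [ν.IsHaarMeasure]
    {N : Set H} (hN : MeasurableSet N) (hν : ν N = 0) :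
    m {y | ∃ x : G × H, QuotientGroup.mk x = y ∧ x.2 ∈ N} = 0 := by
  have := countable_of_discrete Γ
  obtain ⟨s, hs⟩ := exists_isQuotientSection Γ
  obtain ⟨c, hc⟩ := lift_eq_smul_haar hd hs hm Measure.haar ν
  have h0 : lift s m (Set.univ ×ˢ N) = 0 := by
    rw [hc, Measure.smul_apply, Measure.prod_prod, hν, mul_zero, smul_zero]
  rw [lift_apply hs (MeasurableSet.univ.prod hN), ENNReal.tsum_eq_zero] at h0
  refine measure_mono_null ?_ (measure_iUnion_null h0)
  rintro _ ⟨x, rfl, hx⟩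
  refine Set.mem_iUnion.2 ⟨⟨(s (QuotientGroup.mk x))⁻¹ * x, QuotientGroup.eq.1 (hs.mk_eq _)⟩, ?_⟩
  simpa using hx

end UniqueErgodicity

/-! ### The parametrization of the hull by `(G × H)/Γ` -/

section Slices

variable {G H : Type*}
  [Group G] [TopologicalSpace G] [IsTopologicalGroup G] [LocallyCompactSpace G]
  [SecondCountableTopology G] [T2Space G] [MeasurableSpace G] [BorelSpace G]
  [Group H] [TopologicalSpace H] [IsTopologicalGroup H] [LocallyCompactSpace H]
  [SecondCountableTopology H] [T2Space H] [MeasurableSpace H] [BorelSpace H]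
  {Γ : Subgroup (G × H)} {W : Set H}

/-- The projection to `G` of the points of the coset `y` with second coordinate in `W`. -/
def slice (Γ : Subgroup (G × H)) (W : Set H) (y : (G × H) ⧸ Γ) : Set G :=
  {a | ∃ b ∈ W, (QuotientGroup.mk (a, b) : (G × H) ⧸ Γ) = y}

theorem slice_mono {W' : Set H} (h : W ⊆ W') (y : (G × H) ⧸ Γ) : slice Γ W y ⊆ slice Γ W' y :=
  fun _ ⟨b, hb, hy⟩ => ⟨b, h hb, hy⟩

theorem modelSet_eq_slice (Γ : Subgroup (G × H)) (W : Set H) :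
    modelSet Γ W = slice Γ W (QuotientGroup.mk 1) := by
  ext a
  have h (b : H) : (QuotientGroup.mk (a, b) : (G × H) ⧸ Γ) = QuotientGroup.mk 1 ↔ (a, b) ∈ Γ := by
    rw [QuotientGroup.eq, mul_one, inv_mem_iff]
  simp only [modelSet, slice, h, Set.mem_image, Set.mem_inter_iff, SetLike.mem_coe,
    Set.mem_ofPred_eq, Prod.exists, exists_and_right, exists_eq_right]
  exact exists_congr fun b => and_comm

theorem slice_smul (g : G) (y : (G × H) ⧸ Γ) :
    slice Γ W (((g, 1) : G × H) • y) = g • slice Γ W y := by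
  ext a
  rw [Set.mem_smul_set_iff_inv_smul_mem]
  refine exists_congr fun b => and_congr_right fun _ => ?_
  rw [← inv_smul_eq_iff]
  have h : ((g, 1) : G × H)⁻¹ • (QuotientGroup.mk (a, b) : (G × H) ⧸ Γ) =
      QuotientGroup.mk (g⁻¹ • a, b) := by
    change (QuotientGroup.mk (((g, 1) : G × H)⁻¹ * (a, b)) : (G × H) ⧸ Γ) = _
    simp
  rw [h]

theorem isClosed_slice [T2Space ((G × H) ⧸ Γ)] (hW : IsCompact W) (y : (G × H) ⧸ Γ) :
    IsClosed (slice Γ W y) := by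
  have : CompactSpace W := isCompact_iff_compactSpace.1 hW
  have hcl : IsClosed {q : G × W | (QuotientGroup.mk (q.1, (q.2 : H)) : (G × H) ⧸ Γ) = y} :=
    isClosed_eq (QuotientGroup.continuous_mk.comp (by fun_prop)) continuous_const
  convert isClosedMap_fst_of_compactSpace _ hcl using 1
  ext a
  simp [slice]

theorem isOpen_setOf_slice_inter_nonempty {V : Set G} {O : Set H} (hV : IsOpen V)
    (hO : IsOpen O) : IsOpen {y : (G × H) ⧸ Γ | (slice Γ O y ∩ V).Nonempty} := by
  convert QuotientGroup.isOpenMap_coe (N := Γ) _ (hV.prod hO) using 1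
  ext y
  constructor
  · rintro ⟨a, ⟨b, hb, rfl⟩, ha⟩
    exact ⟨(a, b), ⟨ha, hb⟩, rfl⟩
  · rintro ⟨⟨a, b⟩, ⟨ha, hb⟩, rfl⟩
    exact ⟨a, ⟨b, hb, rfl⟩, ha⟩

theorem isOpen_setOf_slice_inter_eq_empty [T2Space ((G × H) ⧸ Γ)] (hW : IsCompact W) {K : Set G}
    (hK : IsCompact K) : IsOpen {y : (G × H) ⧸ Γ | slice Γ W y ∩ K = ∅} := by
  rw [← isClosed_compl_iff]
  convert ((hK.prod hW).image (QuotientGroup.continuous_mk (N := Γ))).isClosed using 1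
  ext y
  rw [Set.mem_compl_iff, Set.mem_ofPred_eq, ← ne_eq, ← Set.nonempty_iff_ne_empty]
  constructor
  · rintro ⟨a, ⟨b, hb, rfl⟩, ha⟩
    exact ⟨(a, b), ⟨ha, hb⟩, rfl⟩
  · rintro ⟨⟨a, b⟩, ⟨ha, hb⟩, rfl⟩
    exact ⟨a, ⟨b, hb, rfl⟩, ha⟩

/-- A closed set `P` is compatible with the coset `y` if it lies between the slices of `y` by the
interior of the window and by the window. -/
def Compatible (W : Set H) (P : ClosedSubset G) (y : (G × H) ⧸ Γ) : Prop :=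
  slice Γ (interior W) y ⊆ P.carrier ∧ P.carrier ⊆ slice Γ W y

/-- The slice by the open set `interior W` is lower semicontinuous in the coset and the slice by the
compact set `W` is upper semicontinuous, so either inclusion, once violated, stays violated nearby.
-/
theorem isClosed_setOf_compatible [T2Space ((G × H) ⧸ Γ)] (hW : IsCompact W) :
    IsClosed {q : ClosedSubset G × ((G × H) ⧸ Γ) | Compatible W q.1 q.2} := by
  have hmiss {K : Set G} (hK : IsCompact K) : IsOpen {P : ClosedSubset G | P.carrier ∩ K = ∅} :=
    TopologicalSpace.isOpen_generateFrom_of_mem (Or.inl ⟨K, hK, rfl⟩)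
  have hhit {V : Set G} (hV : IsOpen V) : IsOpen {P : ClosedSubset G | (P.carrier ∩ V).Nonempty} :=
    TopologicalSpace.isOpen_generateFrom_of_mem (Or.inr ⟨V, hV, rfl⟩)
  have hl : IsClosed {q : ClosedSubset G × ((G × H) ⧸ Γ) |
      slice Γ (interior W) q.2 ⊆ q.1.carrier} := by
    rw [← isOpen_compl_iff, isOpen_iff_mem_nhds]
    rintro ⟨P, y⟩ hPy
    obtain ⟨a, ha, haP⟩ := Set.not_subset.1 hPy
    obtain ⟨K, hKa, hKP, hK⟩ := local_compact_nhds (P.isClosed'.isOpen_compl.mem_nhds haP)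
    have h₁ : {P : ClosedSubset G | P.carrier ∩ K = ∅} ∈ nhds P :=
      (hmiss hK).mem_nhds (Set.disjoint_iff_inter_eq_empty.1
        (Set.disjoint_left.2 fun x hx hxK => hKP hxK hx))
    have h₂ : {y : (G × H) ⧸ Γ | (slice Γ (interior W) y ∩ interior K).Nonempty} ∈ nhds y :=
      (isOpen_setOf_slice_inter_nonempty isOpen_interior isOpen_interior).mem_nhds
        ⟨a, ha, mem_interior_iff_mem_nhds.2 hKa⟩
    filter_upwards [prod_mem_nhds h₁ h₂]
    rintro ⟨Q, z⟩ ⟨hQ, ⟨x, hx, hxK⟩⟩ hsub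
    exact (Set.eq_empty_iff_forall_notMem.1 hQ) x ⟨hsub hx, interior_subset hxK⟩
  have hr : IsClosed {q : ClosedSubset G × ((G × H) ⧸ Γ) | q.1.carrier ⊆ slice Γ W q.2} := by
    rw [← isOpen_compl_iff, isOpen_iff_mem_nhds]
    rintro ⟨P, y⟩ hPy
    obtain ⟨a, haP, ha⟩ := Set.not_subset.1 hPy
    obtain ⟨K, hKa, hKy, hK⟩ :=
      local_compact_nhds ((isClosed_slice hW y).isOpen_compl.mem_nhds ha)
    have h₁ : {P : ClosedSubset G | (P.carrier ∩ interior K).Nonempty} ∈ nhds P :=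
      (hhit isOpen_interior).mem_nhds ⟨a, haP, mem_interior_iff_mem_nhds.2 hKa⟩
    have h₂ : {y : (G × H) ⧸ Γ | slice Γ W y ∩ K = ∅} ∈ nhds y :=
      (isOpen_setOf_slice_inter_eq_empty hW hK).mem_nhds (Set.disjoint_iff_inter_eq_empty.1
        (Set.disjoint_left.2 fun x hx hxK => hKy hxK hx))
    filter_upwards [prod_mem_nhds h₁ h₂]
    rintro ⟨Q, z⟩ ⟨⟨x, hx, hxK⟩, hz⟩ hsub
    exact (Set.eq_empty_iff_forall_notMem.1 hz) x ⟨hsub hx, interior_subset hxK⟩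
  exact hl.inter hr

theorem Compatible.smul {P : ClosedSubset G} {y : (G × H) ⧸ Γ} (h : Compatible W P y) (g : G) :
    Compatible W (g • P) (((g, 1) : G × H) • y) := by
  rw [Compatible, slice_smul, slice_smul, carrier_smul]
  exact ⟨Set.smul_set_mono h.1, Set.smul_set_mono h.2⟩

/-- Projection along the compact quotient is closed, so the closed sets with a compatible coset form
a closed set, and it contains the orbit of the model set. -/
theorem exists_compatible [T2Space ((G × H) ⧸ Γ)] [CompactSpace ((G × H) ⧸ Γ)]
    (hW : IsCompact W) {P : ClosedSubset G} (hP : P ∈ hull (modelSet Γ W)) :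
    ∃ y : (G × H) ⧸ Γ, Compatible W P y := by
  have hcl := isClosedMap_fst_of_compactSpace _ (isClosed_setOf_compatible (Γ := Γ) hW)
  have hsub : hull (modelSet Γ W) ⊆ _ := closure_minimal (fun Q hQ => ?_) hcl
  · obtain ⟨⟨Q, y⟩, h, rfl⟩ := hsub hP
    exact ⟨y, h⟩
  · obtain ⟨g, hg⟩ := hQ
    refine ⟨(Q, ((g, 1) : G × H) • (QuotientGroup.mk 1 : (G × H) ⧸ Γ)), ?_, rfl⟩
    have hQe : Q.carrier = slice Γ W (((g, 1) : G × H) • (QuotientGroup.mk 1 : (G × H) ⧸ Γ)) := by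
      rw [slice_smul, hg, modelSet_eq_slice]
    exact ⟨hQe ▸ slice_mono interior_subset _, hQe.le⟩

theorem slice_inter_nonempty_of_dense (hd : Dense (Prod.snd '' (Γ : Set (G × H)))) {O : Set H}
    (hO : IsOpen O) (hne : O.Nonempty) (y : (G × H) ⧸ Γ) : (slice Γ O y).Nonempty := by
  obtain ⟨⟨g, h⟩, rfl⟩ := QuotientGroup.mk_surjective y
  obtain ⟨c, hc⟩ := hne
  obtain ⟨_, ⟨γ, hγ, rfl⟩, hxO⟩ := hd.exists_mem_open (hO.preimage (continuous_const_mul h))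
    ⟨h⁻¹ * c, by simpa using hc⟩
  exact ⟨g * γ.1, h * γ.2, hxO, QuotientGroup.mk_mul_of_mem (g, h) hγ⟩

/-- Each `γ ∈ Γ` with second coordinate in `b⁻¹ • interior W` gives a point of the first slice.
Injectivity on `G` forces the same `γ` to witness it in the second slice, so its second coordinate
lies in `b'⁻¹ • W`; density and closedness finish. -/
theorem smul_window_subset (hd : Dense (Prod.snd '' (Γ : Set (G × H))))
    (hinj : Set.InjOn Prod.fst (Γ : Set (G × H))) (hW : IsCompact W)
    (hWi : W ⊆ closure (interior W)) {a : G} {b b' : H}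
    (h : slice Γ (interior W) (QuotientGroup.mk (a, b)) ⊆ slice Γ W (QuotientGroup.mk (a, b'))) :
    b⁻¹ • W ⊆ b'⁻¹ • W := by
  have hsub : b⁻¹ • interior W ∩ Prod.snd '' (Γ : Set (G × H)) ⊆ b'⁻¹ • W := by
    rintro _ ⟨hx, γ, hγ, rfl⟩
    rw [Set.mem_smul_set_iff_inv_smul_mem, inv_inv, smul_eq_mul] at hx ⊢
    obtain ⟨c, hc, hce⟩ := h ⟨b * γ.2, hx, QuotientGroup.mk_mul_of_mem (a, b) hγ⟩
    have hmem := Γ.mul_mem (QuotientGroup.eq.1 hce) hγ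
    have hone := hinj hmem Γ.one_mem (by simp)
    have h2 : c⁻¹ * b' * γ.2 = 1 := by simpa using congrArg Prod.snd hone
    rw [mul_assoc, inv_mul_eq_one] at h2
    rwa [← h2]
  calc b⁻¹ • W ⊆ b⁻¹ • closure (interior W) := Set.smul_set_mono hWi
    _ = closure (b⁻¹ • interior W) := (closure_smul ..).symm
    _ ⊆ closure (b⁻¹ • interior W ∩ Prod.snd '' (Γ : Set (G × H))) :=
        closure_minimal (hd.open_subset_closure_inter (isOpen_interior.smul b⁻¹)) isClosed_closure
    _ ⊆ b'⁻¹ • W := closure_minimal hsub (hW.smul b'⁻¹).isClosed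

theorem Compatible.unique (hd : Dense (Prod.snd '' (Γ : Set (G × H))))
    (hinj : Set.InjOn Prod.fst (Γ : Set (G × H))) (hW : IsRegularWindow Γ W)
    {P : ClosedSubset G} {y y' : (G × H) ⧸ Γ} (h : Compatible W P y) (h' : Compatible W P y') :
    y = y' := by
  -- A point `a` of the inner slice of `y` lies in `P`, hence in the slice of `y'`, so both cosets
  -- have representatives with first coordinate `a`.
  obtain ⟨a, ha⟩ := slice_inter_nonempty_of_dense hd isOpen_interior hW.interior_nonempty y
  obtain ⟨b', -, rfl⟩ := h'.2 (h.1 ha)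
  obtain ⟨b, -, rfl⟩ := ha
  have h₁ := smul_window_subset hd hinj hW.compact hW.dense_interior (h.1.trans h'.2)
  have h₂ := smul_window_subset hd hinj hW.compact hW.dense_interior (h'.1.trans h.2)
  have heq : (b' * b⁻¹) • W = W := by
    rw [mul_smul, h₁.antisymm h₂, smul_inv_smul]
  rw [mul_inv_eq_one.1 (hW.aperiodic _ heq)]

/-- The coset `y` is nonsingular if it does not meet `G × ∂W`. -/
def IsNonsingular (W : Set H) (y : (G × H) ⧸ Γ) : Prop :=
  ∀ x : G × H, (QuotientGroup.mk x : (G × H) ⧸ Γ) = y → x.2 ∉ frontier W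

theorem IsNonsingular.slice_interior {y : (G × H) ⧸ Γ} (hy : IsNonsingular W y) :
    slice Γ (interior W) y = slice Γ W y := by
  refine (slice_mono interior_subset y).antisymm ?_
  rintro a ⟨b, hb, hab⟩
  refine ⟨b, ?_, hab⟩
  by_contra hbi
  exact hy (a, b) hab ⟨subset_closure hb, hbi⟩

theorem IsNonsingular.smul {y : (G × H) ⧸ Γ} (hy : IsNonsingular W y) (g : G) :
    IsNonsingular W (((g, 1) : G × H) • y) := by
  intro x hx
  have h := hy (((g, 1) : G × H)⁻¹ * x) (by
    change ((g, 1) : G × H)⁻¹ • (QuotientGroup.mk x : (G × H) ⧸ Γ) = y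
    rw [hx, inv_smul_smul])
  simpa using h

theorem IsNonsingular.eq_slice {y : (G × H) ⧸ Γ} (hy : IsNonsingular W y) {P : ClosedSubset G}
    (h : Compatible W P y) : P.carrier = slice Γ W y :=
  h.2.antisymm (hy.slice_interior ▸ h.1)

theorem measurableSet_setOf_isNonsingular [T2Space ((G × H) ⧸ Γ)] [BorelSpace ((G × H) ⧸ Γ)]
    (hW : IsCompact W) : MeasurableSet {y : (G × H) ⧸ Γ | IsNonsingular W y} := by
  have hfr : IsCompact (frontier W) :=
    hW.of_isClosed_subset isClosed_frontier hW.isClosed.frontier_subset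
  have h : {y : (G × H) ⧸ Γ | IsNonsingular W y}ᶜ =
      ⋃ n, QuotientGroup.mk '' (compactCovering G n ×ˢ frontier W) := by
    ext y
    simp only [IsNonsingular, Set.mem_compl_iff, Set.mem_ofPred_eq, not_forall, not_not,
      Set.mem_iUnion, Set.mem_image, Set.mem_prod]
    constructor
    · rintro ⟨x, hx, hxW⟩
      obtain ⟨n, hn⟩ := exists_mem_compactCovering x.1
      exact ⟨n, x, ⟨hn, hxW⟩, hx⟩
    · rintro ⟨n, x, ⟨-, hxW⟩, hx⟩
      exact ⟨x, hx, hxW⟩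
  rw [← MeasurableSet.compl_iff, h]
  refine MeasurableSet.iUnion fun n => ?_
  exact (((isCompact_compactCovering G n).prod hfr).image QuotientGroup.continuous_mk).measurableSet

/-- The slice of a coset by a compact window, as a closed set. -/
def slicePoint [T2Space ((G × H) ⧸ Γ)] (hW : IsCompact W) (y : (G × H) ⧸ Γ) : ClosedSubset G :=
  ⟨slice Γ W y, isClosed_slice hW y⟩

/-- Missing a compact set is an open condition on every coset since `W` is compact; meeting an open
set is open at a nonsingular coset since `W` can be replaced by its interior there. -/
theorem continuousAt_slicePoint [T2Space ((G × H) ⧸ Γ)] (hW : IsCompact W) {y : (G × H) ⧸ Γ}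
    (hy : IsNonsingular W y) : ContinuousAt (slicePoint (Γ := Γ) hW) y := by
  refine TopologicalSpace.tendsto_nhds_generateFrom_iff.2 ?_
  rintro U (⟨K, hK, rfl⟩ | ⟨V, hV, rfl⟩) hyU
  · exact (isOpen_setOf_slice_inter_eq_empty hW hK).mem_nhds hyU
  · have hyV : (slice Γ (interior W) y ∩ V).Nonempty := by
      rw [hy.slice_interior]
      exact hyU
    filter_upwards [(isOpen_setOf_slice_inter_nonempty hV isOpen_interior).mem_nhds hyV] with z hz
    exact hz.mono (Set.inter_subset_inter_left _ (slice_mono interior_subset z))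

/-- The coset of `(g, γ₂)` equals that of `(gγ₁⁻¹, 1)`, which is in the `G`-orbit, and the `γ₂` are
dense. -/
theorem mem_closure_orbit (hd : Dense (Prod.snd '' (Γ : Set (G × H)))) (y : (G × H) ⧸ Γ) :
    y ∈ closure (Set.range fun g : G => ((g, 1) : G × H) • (QuotientGroup.mk 1 : (G × H) ⧸ Γ)) := by
  obtain ⟨⟨g, h⟩, rfl⟩ := QuotientGroup.mk_surjective y
  have hc : Continuous fun h : H => (QuotientGroup.mk (g, h) : (G × H) ⧸ Γ) :=
    QuotientGroup.continuous_mk.comp (by fun_prop)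
  refine map_mem_closure (f := fun h : H => (QuotientGroup.mk (g, h) : (G × H) ⧸ Γ)) hc (hd h) ?_
  rintro _ ⟨γ, hγ, rfl⟩
  refine ⟨g * γ.1⁻¹, ?_⟩
  change (QuotientGroup.mk ((g * γ.1⁻¹, 1) * 1) : (G × H) ⧸ Γ) = _
  rw [QuotientGroup.eq]
  simpa using hγ

theorem IsNonsingular.slicePoint_mem_hull [T2Space ((G × H) ⧸ Γ)]
    (hd : Dense (Prod.snd '' (Γ : Set (G × H)))) (hW : IsCompact W) {y : (G × H) ⧸ Γ}
    (hy : IsNonsingular W y) : slicePoint hW y ∈ hull (modelSet Γ W) := by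
  have h := (continuousAt_slicePoint hW hy).continuousWithinAt.mem_closure_image
    (mem_closure_orbit hd y)
  refine closure_mono ?_ h
  rintro _ ⟨_, ⟨g, rfl⟩, rfl⟩
  exact ⟨g, (slice_smul g _).trans (by rw [modelSet_eq_slice])⟩

end Slices

/-! ### Borel sections of the hull and its identification with the quotient -/

section Hull

variable {G H : Type*}
  [Group G] [TopologicalSpace G] [IsTopologicalGroup G] [LocallyCompactSpace G]
  [SecondCountableTopology G] [T2Space G] [MeasurableSpace G] [BorelSpace G]
  [Group H] [TopologicalSpace H] [IsTopologicalGroup H] [LocallyCompactSpace H]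
  [SecondCountableTopology H] [T2Space H] [MeasurableSpace H] [BorelSpace H]
  {Γ : Subgroup (G × H)} {W : Set H}

theorem hull.coe_smul {Λ : Set G} (g : G) (P : hull Λ) : ((g • P : hull Λ) : ClosedSubset G) =
    g • (P : ClosedSubset G) := rfl

instance (Λ : Set G) : ContinuousConstSMul G (hull Λ) where
  continuous_const_smul g := (continuous_subtype_val.const_smul g).subtype_mk _

section Section

variable [DiscreteTopology Γ]

/-- Uniform discreteness: nearby points of a slice differ by an element of `Γ` in a fixed compact
set, and the finitely many nontrivial differences are excluded by shrinking `V`. -/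
theorem exists_isOpen_slice_subsingleton (hW : IsCompact W) :
    ∃ V : Set G, IsOpen V ∧ 1 ∈ V ∧ IsCompact (closure V) ∧
      ∀ (x : G) (y : (G × H) ⧸ Γ), (slice Γ W y ∩ x • V).Subsingleton := by
  obtain ⟨C, hC, hC1⟩ := exists_compact_mem_nhds (1 : G)
  have hfin := finite_inter_of_isCompact Γ (hC.prod (hW.inv.mul hW))
  set S : Set G := Prod.fst '' ((Γ : Set (G × H)) ∩ C ×ˢ (W⁻¹ * W)) \ {1} with hS
  have hSfin : S.Finite := (hfin.image _).subset Set.sdiff_subset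
  have hN : C ∩ Sᶜ ∈ nhds (1 : G) :=
    Filter.inter_mem hC1 (hSfin.isClosed.isOpen_compl.mem_nhds fun h => h.2 rfl)
  have hcont : Continuous fun q : G × G => q.1⁻¹ * q.2 := by fun_prop
  have hpre : (fun q : G × G => q.1⁻¹ * q.2) ⁻¹' (C ∩ Sᶜ) ∈ nhds ((1 : G), (1 : G)) :=
    hcont.continuousAt.preimage_mem_nhds (by simpa using hN)
  rw [nhds_prod_eq] at hpre
  obtain ⟨V, hV, hVN⟩ := Filter.mem_prod_same_iff.1 hpre
  refine ⟨interior (V ∩ C), isOpen_interior,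
    mem_interior_iff_mem_nhds.2 (Filter.inter_mem hV hC1),
    hC.closure_of_subset (interior_subset.trans Set.inter_subset_right), ?_⟩
  rintro x y _ ⟨⟨b, hb, hy⟩, u, hu, rfl⟩ _ ⟨⟨b', hb', hy'⟩, u', hu', rfl⟩
  have hmem := hVN (Set.mk_mem_prod (interior_subset hu).1 (interior_subset hu').1)
  have hγ : (u⁻¹ * u', b⁻¹ * b') ∈ Γ := by
    have h := QuotientGroup.eq.1 (hy.trans hy'.symm)
    simpa [mul_assoc] using h
  have hone : u⁻¹ * u' = 1 := by
    by_contra hne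
    exact hmem.2 ⟨⟨_, ⟨hγ, hmem.1, Set.mul_mem_mul (Set.inv_mem_inv.2 hb) hb'⟩, rfl⟩, hne⟩
  rw [inv_mul_eq_one.1 hone]

/-- Every `P` meets one of finitely many translates `x • V` (relative density, from compactness of
the quotient), and in at most one point. Choosing that point is measurable because meeting an open
set is an open condition. -/
theorem exists_isHullSection [CompactSpace ((G × H) ⧸ Γ)] [T2Space ((G × H) ⧸ Γ)]
    (hd : Dense (Prod.snd '' (Γ : Set (G × H)))) (hW : IsCompact W)
    (hWi : (interior W).Nonempty) :
    ∃ σ : hull (modelSet Γ W) → G, IsHullSection (modelSet Γ W) σ := by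
  classical
  obtain ⟨V, hV, hV1, hVc, hVsub⟩ := exists_isOpen_slice_subsingleton (Γ := Γ) hW
  have hhit {O : Set G} (hO : IsOpen O) :
      IsOpen {P : hull (modelSet Γ W) | (P.1.carrier ∩ O).Nonempty} :=
    (TopologicalSpace.isOpen_generateFrom_of_mem (Or.inr ⟨O, hO, rfl⟩) :
      IsOpen {P : ClosedSubset G | (P.carrier ∩ O).Nonempty}).preimage continuous_subtype_val
  obtain ⟨t, ht⟩ := isCompact_univ.elim_finite_subcover
    (fun x : G => {y : (G × H) ⧸ Γ | (slice Γ (interior W) y ∩ x • V).Nonempty})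
    (fun x => isOpen_setOf_slice_inter_nonempty (hV.smul x) isOpen_interior)
    (fun y _ => by
      obtain ⟨a, ha⟩ := slice_inter_nonempty_of_dense hd isOpen_interior hWi y
      exact Set.mem_iUnion.2 ⟨a, a, ha, 1, hV1, mul_one a⟩)
  have hcover (P : hull (modelSet Γ W)) :
      ∃ x ∈ t, P ∈ {P : hull (modelSet Γ W) | (P.1.carrier ∩ x • V).Nonempty} := by
    obtain ⟨y, hy⟩ := exists_compatible hW P.2
    obtain ⟨x, hx, a, ha, haV⟩ := Set.mem_iUnion₂.1 (ht (Set.mem_univ y))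
    exact ⟨x, hx, a, hy.1 ha, haV⟩
  have htne : t.Nonempty := by
    obtain ⟨x, hx, -⟩ := Set.mem_iUnion₂.1
      (ht (Set.mem_univ (QuotientGroup.mk 1 : (G × H) ⧸ Γ)))
    exact ⟨x, hx⟩
  have hsub (x : G) (P : hull (modelSet Γ W)) : (P.1.carrier ∩ x • V).Subsingleton := by
    obtain ⟨y, hy⟩ := exists_compatible hW P.2
    exact (hVsub x y).anti (Set.inter_subset_inter_left _ hy.2)
  -- The value `1` off the set where `P` meets `x • V` is never selected.
  set u : G → hull (modelSet Γ W) → G := fun x P =>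
    if h : (P.1.carrier ∩ x • V).Nonempty then h.some else 1 with hu
  have hum (x : G) : Measurable (u x) := by
    refine measurable_of_isOpen fun O hO => ?_
    have hpre : u x ⁻¹' O = {P | (P.1.carrier ∩ (x • V ∩ O)).Nonempty} ∪
        ({P | (P.1.carrier ∩ x • V).Nonempty}ᶜ ∩ {_P | (1 : G) ∈ O}) := by
      ext P
      by_cases h : (P.1.carrier ∩ x • V).Nonempty
      · have huP : u x P = h.some := dif_pos h
        have hne : (P.1.carrier ∩ (x • V ∩ O)).Nonempty ↔ h.some ∈ O := by
          constructor
          · rintro ⟨a, haP, haV, haO⟩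
            rwa [hsub x P h.some_mem ⟨haP, haV⟩]
          · exact fun hO' => ⟨h.some, h.some_mem.1, h.some_mem.2, hO'⟩
        simp [huP, h, hne]
      · have huP : u x P = 1 := dif_neg h
        have hne : ¬ (P.1.carrier ∩ (x • V ∩ O)).Nonempty := fun hne =>
          h (hne.mono (Set.inter_subset_inter_right _ Set.inter_subset_left))
        simp [huP, h, hne]
    rw [hpre]
    exact (hhit ((hV.smul x).inter hO)).measurableSet.union
      ((hhit (hV.smul x)).measurableSet.compl.inter (MeasurableSet.const _))
  obtain ⟨σ, hσ, h⟩ := exists_measurable_selection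
    (fun x : G => {P : hull (modelSet Γ W) | (P.1.carrier ∩ x • V).Nonempty}) u
    (fun x => (hhit (hV.smul x)).measurableSet) hum t htne hcover
  have hmem (P : hull (modelSet Γ W)) : ∃ x ∈ t, σ P ∈ P.1.carrier ∩ x • V := by
    obtain ⟨x, hx, hP, hσP⟩ := h P
    have hne : (P.1.carrier ∩ x • V).Nonempty := hP
    refine ⟨x, hx, ?_⟩
    rw [hσP, hu]
    simp only [dif_pos hne]
    exact hne.some_mem
  refine ⟨σ, hσ, ?_, fun P => (hmem P).choose_spec.2.1⟩
  have hK : IsCompact (⋃ x ∈ t, x • closure V) := t.isCompact_biUnion fun x _ => hVc.smul x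
  refine hK.closure_of_subset ?_
  rintro _ ⟨P, rfl⟩
  obtain ⟨x, hx, -, hP⟩ := hmem P
  exact Set.mem_iUnion₂.2 ⟨x, hx, Set.smul_set_mono subset_closure hP⟩

end Section

/-- The parametrization of the hull of a regular model set: a continuous `G`-equivariant map to
`(G × H)/Γ` which has a measurable inverse over the nonsingular cosets. -/
structure HullParametrization (Γ : Subgroup (G × H)) (W : Set H)
    (β : hull (modelSet Γ W) → (G × H) ⧸ Γ) (Φ : (G × H) ⧸ Γ → hull (modelSet Γ W)) : Prop where
  measurable : Measurable β
  measurable_inv : Measurable Φ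
  smul : ∀ (g : G) P, β (g • P) = ((g, 1) : G × H) • β P
  smul_inv : ∀ (g : G) y, IsNonsingular W y → Φ (((g, 1) : G × H) • y) = g • Φ y
  subset_slice : ∀ P, P.1.carrier ⊆ slice Γ W (β P)
  apply_inv : ∀ y, IsNonsingular W y → β (Φ y) = y
  inv_apply : ∀ P, IsNonsingular W (β P) → Φ (β P) = P

theorem exists_hullParametrization [CompactSpace ((G × H) ⧸ Γ)] [T2Space ((G × H) ⧸ Γ)]
    [BorelSpace ((G × H) ⧸ Γ)] (hd : Dense (Prod.snd '' (Γ : Set (G × H))))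
    (hinj : Set.InjOn Prod.fst (Γ : Set (G × H))) (hW : IsRegularWindow Γ W) :
    ∃ β Φ, HullParametrization Γ W β Φ := by
  classical
  choose β hβ using fun P : hull (modelSet Γ W) => exists_compatible hW.compact P.2
  have huniq {P : hull (modelSet Γ W)} {y : (G × H) ⧸ Γ} (h : Compatible W P.1 y) : β P = y :=
    (hβ P).unique hd hinj hW h
  -- Closed graph and compact target.
  have hcont : Continuous β := by
    refine continuous_iff_isClosed.2 fun C hC => ?_
    have hg : IsClosed {q : hull (modelSet Γ W) × ((G × H) ⧸ Γ) |
        Compatible W q.1.1 q.2 ∧ q.2 ∈ C} :=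
      ((isClosed_setOf_compatible hW.compact).preimage
        (continuous_subtype_val.prodMap continuous_id)).inter (hC.preimage continuous_snd)
    convert isClosedMap_fst_of_compactSpace _ hg using 1
    ext P
    constructor
    · exact fun hP => ⟨(P, β P), ⟨hβ P, hP⟩, rfl⟩
    · rintro ⟨⟨P, y⟩, ⟨h, hy⟩, rfl⟩
      rw [Set.mem_preimage, huniq h]
      exact hy
  set P₀ : hull (modelSet Γ W) := ⟨⟨modelSet Γ W, modelSet_eq_slice Γ W ▸
    isClosed_slice hW.compact _⟩, subset_closure ⟨1, (one_smul G _).symm⟩⟩ with hP₀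
  -- On singular cosets the constant `P₀` is arbitrary; only measurability is needed there.
  set Φ : (G × H) ⧸ Γ → hull (modelSet Γ W) := fun y =>
    if h : IsNonsingular W y then ⟨slicePoint hW.compact y, h.slicePoint_mem_hull hd hW.compact⟩
    else P₀ with hΦdef
  have hΦ {y : (G × H) ⧸ Γ} (h : IsNonsingular W y) : (Φ y).1 = slicePoint hW.compact y := by
    simp only [hΦdef, dif_pos h]
  have hcompat {y : (G × H) ⧸ Γ} (h : IsNonsingular W y) : Compatible W (Φ y).1 y := by
    rw [hΦ h]
    exact ⟨h.slice_interior.le, subset_rfl⟩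
  refine ⟨β, Φ, hcont.measurable, ?_, ?_, ?_, fun P => (hβ P).2, fun y hy => huniq (hcompat hy), ?_⟩
  · have hcon : ContinuousOn Φ {y | IsNonsingular W y} := by
      rw [Topology.IsInducing.subtypeVal.continuousOn_iff]
      refine ContinuousOn.congr (f := slicePoint hW.compact) (fun y hy => ?_) fun y hy => hΦ hy
      exact (continuousAt_slicePoint hW.compact hy).continuousWithinAt
    have hpw : {y | IsNonsingular W y}.piecewise Φ (fun _ => P₀) = Φ := by
      funext y
      by_cases hy : IsNonsingular W y
      · exact Set.piecewise_eq_of_mem _ _ _ hy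
      · rw [Set.piecewise_eq_of_notMem _ _ _ hy]
        simp only [hΦdef, dif_neg hy]
    rw [← hpw]
    exact hcon.measurable_piecewise continuousOn_const
      (measurableSet_setOf_isNonsingular hW.compact)
  · exact fun g P => huniq ((hβ P).smul g)
  · intro g y hy
    refine Subtype.ext (ClosedSubset.ext ?_)
    rw [hull.coe_smul, carrier_smul, hΦ hy, hΦ (hy.smul g)]
    exact slice_smul g y
  · intro P hP
    refine Subtype.ext (ClosedSubset.ext ?_)
    rw [hΦ hP]
    exact (hP.eq_slice (hβ P)).symm

theorem IsInvariantProbability.map_fst_smul {m : Measure ((G × H) ⧸ Γ)}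
    (hm : IsInvariantProbability (G × H) m) (g : G) :
    m.map (fun y => ((g, 1) : G × H) • y) = m := hm.map_smul (g, 1)

/-! ### Invariant measures on the hull and on the quotient -/

section Measures

variable [DiscreteTopology Γ] [CompactSpace ((G × H) ⧸ Γ)] [T2Space ((G × H) ⧸ Γ)]
  [BorelSpace ((G × H) ⧸ Γ)] {m : Measure ((G × H) ⧸ Γ)} {ν : Measure (hull (modelSet Γ W))}
  {β : hull (modelSet Γ W) → (G × H) ⧸ Γ} {Φ : (G × H) ⧸ Γ → hull (modelSet Γ W)}

theorem ae_isNonsingular (hd : Dense (Prod.snd '' (Γ : Set (G × H)))) (hW : IsRegularWindow Γ W)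
    [IsFiniteMeasure m] (hm : ∀ g : G, m.map (fun y => ((g, 1) : G × H) • y) = m) :
    ∀ᵐ y ∂m, IsNonsingular W y := by
  have h := measure_meets_null hd hm Measure.haar
    (measurableSet_frontier (s := W)) hW.jordan
  rw [ae_iff]
  refine measure_mono_null (fun y hy => ?_) h
  simpa [IsNonsingular] using hy

theorem HullParametrization.map_eq (hβ : HullParametrization Γ W β Φ)
    (hd : Dense (Prod.snd '' (Γ : Set (G × H)))) (hν : IsInvariantProbability G ν)
    (hm : IsInvariantProbability (G × H) m) : ν.map β = m := by
  have := hm.isProbability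
  have := hν.isProbability
  have := Measure.isProbabilityMeasure_map (μ := ν) hβ.measurable.aemeasurable
  refine eq_of_invariant hd (fun g => ?_) hm.map_fst_smul
  rw [Measure.map_map (measurable_const_smul _) hβ.measurable]
  conv_rhs => rw [← hν.map_smul g, Measure.map_map hβ.measurable (measurable_const_smul g)]
  congr 1
  funext P
  exact (hβ.smul g P).symm

theorem HullParametrization.ae_isNonsingular_apply (hβ : HullParametrization Γ W β Φ)
    (hd : Dense (Prod.snd '' (Γ : Set (G × H)))) (hW : IsRegularWindow Γ W)
    (hν : IsInvariantProbability G ν) (hm : IsInvariantProbability (G × H) m) :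
    ∀ᵐ P ∂ν, IsNonsingular W (β P) := by
  have := hm.isProbability
  have h := ae_isNonsingular hd hW hm.map_fst_smul
  rw [← hβ.map_eq hd hν hm] at h
  exact ae_of_ae_map hβ.measurable.aemeasurable h

/-- `Φ ∘ β` is the identity almost everywhere for `ν`, and `β` carries `ν` to `m`. Uniqueness of the
invariant measure on the hull follows. -/
theorem HullParametrization.map_inv_eq (hβ : HullParametrization Γ W β Φ)
    (hd : Dense (Prod.snd '' (Γ : Set (G × H)))) (hW : IsRegularWindow Γ W)
    (hν : IsInvariantProbability G ν) (hm : IsInvariantProbability (G × H) m) :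
    m.map Φ = ν := by
  have h := hβ.ae_isNonsingular_apply hd hW hν hm
  rw [← hβ.map_eq hd hν hm, Measure.map_map hβ.measurable_inv hβ.measurable]
  conv_rhs => rw [← Measure.map_id (μ := ν)]
  exact Measure.map_congr (h.mono hβ.inv_apply)

theorem HullParametrization.isInvariantProbability_map_inv (hβ : HullParametrization Γ W β Φ)
    (hd : Dense (Prod.snd '' (Γ : Set (G × H)))) (hW : IsRegularWindow Γ W)
    (hm : IsInvariantProbability (G × H) m) : IsInvariantProbability G (m.map Φ) := by
  have := hm.isProbability
  refine ⟨Measure.isProbabilityMeasure_map hβ.measurable_inv.aemeasurable, fun g => ?_⟩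
  rw [Measure.map_map (measurable_const_smul g) hβ.measurable_inv]
  conv_rhs => rw [← hm.map_fst_smul g,
    Measure.map_map hβ.measurable_inv (measurable_const_smul _)]
  exact Measure.map_congr ((ae_isNonsingular hd hW hm.map_fst_smul).mono
    fun y hy => (hβ.smul_inv g y hy).symm)

end Measures

end Hull

/-! ### Comparison of the two induced actions -/

/-- The action obtained by transporting an affine isometric action along an affine isometry. -/
noncomputable def transportAction {L E₁ E₂ : Type*} [Group L] [NormedAddCommGroup E₁]
    [NormedSpace ℝ E₁]
    [NormedAddCommGroup E₂] [NormedSpace ℝ E₂] (A : E₁ ≃ᵃⁱ[ℝ] E₂) (ρ : L →* (E₂ ≃ᵃⁱ[ℝ] E₂)) :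
    L →* (E₁ ≃ᵃⁱ[ℝ] E₁) where
  toFun g := (A.trans (ρ g)).trans A.symm
  map_one' := by
    ext1 v
    simp
  map_mul' g h := by
    ext1 v
    simp

theorem transportAction_apply {L E₁ E₂ : Type*} [Group L] [NormedAddCommGroup E₁]
    [NormedSpace ℝ E₁] [NormedAddCommGroup E₂] [NormedSpace ℝ E₂] (A : E₁ ≃ᵃⁱ[ℝ] E₂)
    (ρ : L →* (E₂ ≃ᵃⁱ[ℝ] E₂)) (g : L) (v : E₁) :
    transportAction A ρ g v = A.symm (ρ g (A v)) := rfl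

/-- A finite stock `T` of candidates lets preimages under `π` be chosen measurably, one candidate at
a time. -/
theorem exists_simpleFunc_lift {Y M Δ : Type*} [MeasurableSpace Y] [MeasurableSpace M]
    [MeasurableSingletonClass M] [Nonempty Δ] {f : Y → M} (hf : Measurable f) (π : Δ → M)
    (T : Finset Δ) : ∃ c : SimpleFunc Y Δ, ∀ y, (∃ δ ∈ T, π δ = f y) → π (c y) = f y := by
  classical
  induction T using Finset.induction_on with
  | empty => exact ⟨SimpleFunc.const Y (Classical.arbitrary Δ), by simp⟩
  | insert δ T _ ih =>
    obtain ⟨c, hc⟩ := ih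
    refine ⟨SimpleFunc.piecewise (f ⁻¹' {π δ}) (hf (measurableSet_singleton _))
      (SimpleFunc.const Y δ) c, ?_⟩
    rintro y ⟨ε, hε, hy⟩
    rw [SimpleFunc.piecewise_apply]
    split_ifs with h
    · exact h.symm
    · refine hc y ⟨ε, ?_, hy⟩
      refine (Finset.mem_insert.1 hε).resolve_left ?_
      rintro rfl
      exact h hy.symm

section Comparison

variable {G H : Type*}
  [Group G] [TopologicalSpace G] [IsTopologicalGroup G] [LocallyCompactSpace G]
  [SecondCountableTopology G] [T2Space G] [MeasurableSpace G] [BorelSpace G]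
  [Group H] [TopologicalSpace H] [IsTopologicalGroup H] [LocallyCompactSpace H]
  [SecondCountableTopology H] [T2Space H] [MeasurableSpace H] [BorelSpace H]
  {Γ : Subgroup (G × H)} {W : Set H}
  [DiscreteTopology Γ] [CompactSpace ((G × H) ⧸ Γ)] [T2Space ((G × H) ⧸ Γ)]
  [BorelSpace ((G × H) ⧸ Γ)] {m : Measure ((G × H) ⧸ Γ)} {ν : Measure (hull (modelSet Γ W))}
  {β : hull (modelSet Γ W) → (G × H) ⧸ Γ} {Φ : (G × H) ⧸ Γ → hull (modelSet Γ W)}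
  {σ : hull (modelSet Γ W) → G} {s : (G × H) ⧸ Γ → G × H}

/-- The sections of the hull and of `(G × H)/Γ` differ by a simple function with values
in `Γ`. -/
theorem HullParametrization.exists_transfer (hβ : HullParametrization Γ W β Φ)
    (hW : IsCompact W) (hσ : IsHullSection (modelSet Γ W) σ) (hs : IsQuotientSection Γ s) :
    ∃ c : SimpleFunc ((G × H) ⧸ Γ) Γ, ∀ y, IsNonsingular W y →
      (c y : G × H).1 = (s y).1⁻¹ * σ (Φ y) := by
  have hK : IsCompact ((closure (Set.range s))⁻¹ * (closure (Set.range σ) ×ˢ W)) :=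
    hs.bounded.inv.mul (hσ.bounded.prod hW)
  have hfin := (finite_inter_of_isCompact Γ hK).preimage
    (Subtype.val_injective (p := fun x => x ∈ Γ)).injOn
  obtain ⟨c, hc⟩ := exists_simpleFunc_lift
    ((hs.measurable.fst.inv).mul (hσ.measurable.comp hβ.measurable_inv))
    (fun γ : Γ => (γ : G × H).1) hfin.toFinset
  refine ⟨c, fun y hy => hc y ?_⟩
  -- The point `σ(Φ y)` lies in `Φ y`, hence in the slice of `y`; the witness `b` completes it to a
  -- representative of `y`.
  obtain ⟨b, hb, hby⟩ := hβ.subset_slice (Φ y) (hσ.mem (Φ y))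
  rw [hβ.apply_inv y hy] at hby
  have hmem : (s y)⁻¹ * (σ (Φ y), b) ∈ Γ := QuotientGroup.eq.1 ((hs.mk_eq y).trans hby.symm)
  refine ⟨⟨_, hmem⟩, ?_, rfl⟩
  rw [Set.Finite.mem_toFinset]
  exact ⟨hmem, Set.mul_mem_mul (Set.inv_mem_inv.2 (subset_closure ⟨y, rfl⟩))
    ⟨subset_closure ⟨_, rfl⟩, hb⟩⟩

theorem HullParametrization.exists_affineIsometryEquiv {E : Type*} [NormedAddCommGroup E]
    [NormedSpace ℝ E] {p : ℝ≥0∞} [Fact (1 ≤ p)] [IsFiniteMeasure m] [IsFiniteMeasure ν]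
    (hβ : HullParametrization Γ W β Φ) (hd : Dense (Prod.snd '' (Γ : Set (G × H))))
    (hW : IsRegularWindow Γ W) (hν : IsInvariantProbability G ν)
    (hm : IsInvariantProbability (G × H) m) (hσ : IsHullSection (modelSet Γ W) σ)
    (hs : IsQuotientSection Γ s)
    (hgen : Subgroup.closure (modelSet Γ W) = Γ.map (MonoidHom.fst G H))
    (ρ₀ : Subgroup.closure (modelSet Γ W) →* (E ≃ᵃⁱ[ℝ] E)) :
    ∃ A : Lp E p ν ≃ᵃⁱ[ℝ] Lp E p m, IsInduced ν σ ρ₀ ((transportAction A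
      (inducedAction p hm hs (ρ₀.comp (projection hgen)))).comp (MonoidHom.inl G H)) := by
  obtain ⟨c, hc⟩ := hβ.exists_transfer hW.compact hσ hs
  set κ := ρ₀.comp (projection hgen) with hκ
  have hY : ∀ᵐ y ∂m, IsNonsingular W y := ae_isNonsingular hd hW hm.map_fst_smul
  have hX : ∀ᵐ P ∂ν, IsNonsingular W (β P) := hβ.ae_isNonsingular_apply hd hW hν hm
  have hΦm : MeasurePreserving Φ m ν := ⟨hβ.measurable_inv, hβ.map_inv_eq hd hW hν hm⟩
  have hβm : MeasurePreserving β ν m := ⟨hβ.measurable, hβ.map_eq hd hν hm⟩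
  set A : Lp E p ν ≃ᵃⁱ[ℝ] Lp E p m := twistEquiv κ c ((c.comp β hβ.measurable)⁻¹) hΦm hβm
    (hY.mono hβ.apply_inv) (hX.mono hβ.inv_apply)
    (hY.mono fun y hy => by simp [hβ.apply_inv y hy])
    (by simp) with hA
  refine ⟨A, fun g f => ?_⟩
  have hgm := hm.measurePreserving ((g, 1) : G × H)⁻¹
  have hinner : inducedAction p hm hs κ (g, 1) (A f) =
      twist κ (hs.cocycle (g, 1) * c.comp _ hgm.measurable) (hΦm.comp hgm) f := by
    rw [inducedAction_apply, hA, twistEquiv_apply]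
    exact twist_twist κ hgm hΦm _ (by simp) (by simp) f
  have hgν := hν.measurePreserving g⁻¹
  have hsm (P : hull (modelSet Γ W)) : ((g, 1) : G × H)⁻¹ • β P = β (g⁻¹ • P) := by
    rw [hβ.smul, Prod.inv_mk, inv_one]
  -- Conjugating by `A` replaces the cocycle of `s` at `β P` by the cohomologous one `c(β P)⁻¹ ·
  -- cocycle · c((g, 1)⁻¹ β P)`.
  have houter : transportAction A (inducedAction p hm hs κ) (g, 1) f =
      twist κ ((c.comp β hβ.measurable)⁻¹ *
        (hs.cocycle (g, 1) * c.comp _ hgm.measurable).comp β hβ.measurable) hgν f := by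
    rw [transportAction_apply, hinner, hA, twistEquiv_symm_apply]
    refine twist_twist κ hβm (hΦm.comp hgm) _ (by simp) ?_ f
    filter_upwards [hX] with P hP
    rw [Function.comp_apply, Prod.inv_mk, inv_one, hβ.smul_inv _ _ hP, hβ.inv_apply P hP]
  have hcoe := coeFn_twist κ ((c.comp β hβ.measurable)⁻¹ *
        (hs.cocycle (g, 1) * c.comp _ hgm.measurable).comp β hβ.measurable) hgν f
  rw [← houter] at hcoe
  filter_upwards [hcoe, hX] with P hP hPn
  refine ⟨projection hgen _, ?_, hP⟩
  have h1 := hc (β P) hPn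
  have h2 := hc (((g, 1) : G × H)⁻¹ • β P) (by
    rw [Prod.inv_mk, inv_one]
    exact hPn.smul g⁻¹)
  have hΦ1 : Φ (β P) = P := hβ.inv_apply P hPn
  have hΦ2 : Φ (((g, 1) : G × H)⁻¹ • β P) = g⁻¹ • P := by
    rw [Prod.inv_mk, inv_one, hβ.smul_inv _ _ hPn, hΦ1]
  rw [hΦ1] at h1
  rw [hΦ2] at h2
  -- With first coordinate `c = s⁻¹σ`, the factors of `s` cancel and `σ(P)⁻¹ g σ(g⁻¹P)` remains.
  change (c (β P) : G × H).1⁻¹ * ((hs.cocycle (g, 1) (β P) : G × H).1 *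
    (c (((g, 1) : G × H)⁻¹ • β P) : G × H).1) = _
  rw [h1, h2, hs.coe_cocycle]
  simp only [Prod.fst_mul, Prod.fst_inv]
  group

theorem standardBorelSpace_quotient (Γ : Subgroup (G × H)) [CompactSpace ((G × H) ⧸ Γ)]
    [T2Space ((G × H) ⧸ Γ)] [BorelSpace ((G × H) ⧸ Γ)] : StandardBorelSpace ((G × H) ⧸ Γ) := by
  let _ := TopologicalSpace.metrizableSpaceMetric ((G × H) ⧸ Γ)
  infer_instance

end Comparison

end ModelSets

/-! ### The main theorem -/

theorem proposition3p8 {G H E : Type*}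
    [Group G] [TopologicalSpace G] [IsTopologicalGroup G] [LocallyCompactSpace G]
    [SecondCountableTopology G] [T2Space G] [MeasurableSpace G] [BorelSpace G]
    [Group H] [TopologicalSpace H] [IsTopologicalGroup H] [LocallyCompactSpace H]
    [SecondCountableTopology H] [T2Space H] [MeasurableSpace H] [BorelSpace H]
    -- the uniform cut-and-project scheme, the regular symmetric model set, the large window
    (Γ : Subgroup (G × H)) (hΓ : ModelSets.IsUniformCutAndProjectScheme Γ)
    (W : Set H) (hW : ModelSets.IsRegularWindow Γ W)
    (Λ : Set G) (hΛ : Λ = ModelSets.modelSet Γ W) (hsymm : Λ⁻¹ = Λ)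
    (F : Set (G × H)) (hF : ModelSets.IsFundamentalSet Γ F)
    (hlarge : ModelSets.IsLargeWindow F W)
    -- the projection to `G` is an isomorphism from `Γ` onto the group generated by `Λ`
    (hgen : Subgroup.closure Λ = Γ.map (MonoidHom.fst G H))
    -- the affine isometric action of the group generated by `Λ` on an `L^p`-space
    (p : ℝ≥0∞) [Fact (1 ≤ p)] (hp : 1 < p) (hp' : p < ∞)
    [NormedAddCommGroup E] [NormedSpace ℝ E] (hE : ModelSets.IsLpSpace p E)
    (ρ₀ : Subgroup.closure Λ →* (E ≃ᵃⁱ[ℝ] E)) :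
    -- the invariant measures and the bounded Borel sections exist
    (∃! ν : Measure (ModelSets.hull Λ), ModelSets.IsInvariantProbability G ν) ∧
    (∃! m : Measure ((G × H) ⧸ Γ), ModelSets.IsInvariantProbability (G × H) m) ∧
    (∃ σ : ModelSets.hull Λ → G, ModelSets.IsHullSection Λ σ) ∧
    (∃ s : (G × H) ⧸ Γ → G × H, ModelSets.IsQuotientSection Γ s) ∧
    -- whichever sections are used, the induced actions are isomorphic
    ∀ (ν : Measure (ModelSets.hull Λ)) (m : Measure ((G × H) ⧸ Γ))
      (σ : ModelSets.hull Λ → G) (s : (G × H) ⧸ Γ → G × H),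
      ModelSets.IsInvariantProbability G ν → ModelSets.IsInvariantProbability (G × H) m →
      ModelSets.IsHullSection Λ σ → ModelSets.IsQuotientSection Γ s →
      ∃ (ρX : G →* (Lp E p ν ≃ᵃⁱ[ℝ] Lp E p ν)) (ρY : G × H →* (Lp E p m ≃ᵃⁱ[ℝ] Lp E p m)),
        ModelSets.IsInduced ν σ ρ₀ ρX ∧
        ModelSets.IsInduced m s (ρ₀.comp (ModelSets.projection hgen)) ρY ∧
        ModelSets.IsAffineLpAction p ρX ∧
        ModelSets.IsAffineLpAction p ρY ∧
        ModelSets.AreIsomorphic ρX (ρY.comp (MonoidHom.inl G H)) ∧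
        ∃ ρext : G × H →* (Lp E p ν ≃ᵃⁱ[ℝ] Lp E p ν),
          ModelSets.IsAffineLpAction p ρext ∧ ∀ g : G, ρext (g, 1) = ρX g := by
  subst hΛ
  have := hΓ.discrete
  have := hΓ.cocompact
  have := ModelSets.t2Space_quotient_of_discrete Γ
  have := ModelSets.borelSpace_quotient_of_discrete Γ
  have := ModelSets.standardBorelSpace_quotient Γ
  have hd := hΓ.dense_snd
  obtain ⟨β, Φ, hβ⟩ := ModelSets.exists_hullParametrization hd hΓ.injective_fst hW
  obtain ⟨m₀, hm₀⟩ :=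
    (ModelSets.exists_isInvariantProbability_and_haar Γ (Measure.haar : Measure (G × H))).1
  refine ⟨⟨m₀.map Φ, hβ.isInvariantProbability_map_inv hd hW hm₀,
      fun ν hν => (hβ.map_inv_eq hd hW hν hm₀).symm⟩, ⟨m₀, hm₀, fun m hm => ?_⟩,
    ModelSets.exists_isHullSection hd hW.compact hW.interior_nonempty,
    ModelSets.exists_isQuotientSection Γ, ?_⟩
  · have := hm.isProbability
    have := hm₀.isProbability
    exact ModelSets.eq_of_invariant hd hm.map_fst_smul hm₀.map_fst_smul
  intro ν m σ s hν hm hσ hs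
  have := hν.isProbability
  have := hm.isProbability
  have : Nonempty ((G × H) ⧸ Γ) := ⟨QuotientGroup.mk 1⟩
  obtain ⟨A, hA⟩ := hβ.exists_affineIsometryEquiv (p := p) hd hW hν hm hσ hs hgen ρ₀
  set ρY := ModelSets.inducedAction p hm hs (ρ₀.comp (ModelSets.projection hgen)) with hρY
  have hcont (f : Lp E p m) : Continuous fun g => ρY g f :=
    ModelSets.continuous_inducedAction hm hs _ hp'.ne f
  have hLp : ModelSets.IsLpSpace p (Lp E p m) := hE.lp m hp'.ne
  have hLp' : ModelSets.IsLpSpace p (Lp E p ν) := hLp.of_affineIsometryEquiv A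
  have hcont' (f : Lp E p ν) : Continuous fun g => ModelSets.transportAction A ρY g f :=
    A.symm.continuous.comp (hcont (A f))
  -- The action on the hull is taken to be the transported `G × H`-action restricted to `G`; `hA`
  -- identifies it as induced, so the isomorphism `A` and the extension come with it.
  refine ⟨(ModelSets.transportAction A ρY).comp (MonoidHom.inl G H), ρY, hA,
    ModelSets.isInduced_inducedAction hm hs _, ?_, ?_, ⟨A, fun g v => ?_⟩,
    ModelSets.transportAction A ρY, ?_, fun g => rfl⟩
  · exact ModelSets.isAffineLpAction_of_continuous hLp' _
      fun f => (hcont' f).comp (Continuous.prodMk_left 1)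
  · exact ModelSets.isAffineLpAction_of_continuous hLp _ hcont
  · exact A.apply_symm_apply _
  · exact ModelSets.isAffineLpAction_of_continuous hLp' _ hcont'
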